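/- Fix $d\ge 0$, $1\le p\le\infty$ and $0<q\le\infty$. For $a>0$ and a real $d\times d$ matrix $M$ put $a^M=\exp(M\log a)$, and let $\mathcal E^+$ be the set of real $d\times d$ matrices all of whose complex eigenvalues have positive real part. Every real square matrix can be written uniquely as $M=D+S+N$ with $D,S,N$ real and pairwise commuting, $D$ diagonalizable over $\mathbb R$, $S$ diagonalizable over $\mathbb C$ with purely imaginary (possibly zero) eigenvalues, and $N$ nilpotent; $D$ is called the real diagonalizable part of $M$. For $E\in\mathcal E^+$, an $(\mathbb R^d,E^{t})$ pseudo-norm is a continuous function $\rho:\mathbb R^d\to\mathbb R$ with $\rho(a^{E^t}x)=a\rho(x)$ for all $a>0$, $x\in\mathbb R^d$, and $\rho(x)>0$ for $x\ne0$. Given such a $\rho$, an anisotropic Littlewood--Paley analysis is a sequence $(\psi_j)_{j\ge0}$ of complex-valued Schwartz functions with $\widehat{\psi_0}(\xi)=1$ if $\rho(\xi)\le1$, $\widehat{\psi_0}(\xi)=0$ if $\rho(\xi)\ge2$, and $\widehat{\psi_j}(\xi)=\widehat{\psi_0}(2^{-jE^t}\xi)-\widehat{\psi_0}(2^{-(j-1)E^t}\xi)$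 for $j\ge1$. For $s\in\mathbb R$ let $$B^s_{p,q}(\mathbb R^d,E)=\Big\{f\in\mathcal S'(\mathbb R^d):\ \Big(\sum_{j\ge0}2^{jsq}\|f*\psi_j\|_{L^p}^q\Big)^{1/q}<\infty\Big\}$$ (a supremum over $j$ if $q=\infty$), let $B^s_{p,q,loc}(\mathbb R^d,E)$ be the set of $f\in L^p_{loc}(\mathbb R^d)$ such that $\varphi f\in B^s_{p,q}(\mathbb R^d,E)$ for every smooth compactly supported $\varphi$, and put $$\alpha_{f,loc}(E,p,q)=\sup\{s>0:\ f\in B^s_{p,q,loc}(\mathbb R^d,E)\}\in[-\infty,+\infty],\qquad \sup\emptyset=-\infty .$$ Let $\{X(x)\}_{x\in\mathbb R^d}$ be a real- or complex-valued random field (Gaussian or not). Then its anisotropic local critical exponent depends only on the real diagonalizable part of the anisotropy: if $E_1,E_2\in\mathcal E^+$ have the same real diagonalizable part, then for every sample path of $X$ that belongs to $L^p_{loc}(\mathbb R^d)$, $$\alpha_{X,loc}(E_1,p,q)=\alpha_{X,loc}(E_2,p,q),$$ whatever pseudo-norms and Littlewood--Paley analyses are used to define the two sides. -/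

import Mathlib

open MeasureTheory Matrix
open scoped SchwartzMap FourierTransform ENNReal

noncomputable section

namespace AnisoBesov

/-- The Euclidean space of dimension `d`. -/
abbrev Space (d : ℕ) : Type := EuclideanSpace ℝ (Fin d)

/-- `a ^ M = exp (log a • M)` for a real `a > 0` and a real square matrix `M`. -/
def matPow {d : ℕ} (a : ℝ) (M : Matrix (Fin d) (Fin d) ℝ) : Matrix (Fin d) (Fin d) ℝ :=
  NormedSpace.exp (Real.log a • M)

/-- `a ^ M` applied to a vector. -/
def scale {d : ℕ} (a : ℝ) (M : Matrix (Fin d) (Fin d) ℝ) (x : Space d) : Space d :=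
  Matrix.toEuclideanLin (matPow a M) x

/-- The class of anisotropies: real matrices whose complex eigenvalues all have positive
real part. -/
def IsAnisotropy {d : ℕ} (E : Matrix (Fin d) (Fin d) ℝ) : Prop :=
  ∀ z ∈ spectrum ℂ (E.map (fun t : ℝ => (t : ℂ))), 0 < z.re

/-- `A` is diagonalizable over the field `K`, with eigenvalues `v`. -/
def IsDiagonalizableWith {K : Type*} [Field K] {d : ℕ} (A : Matrix (Fin d) (Fin d) K)
    (v : Fin d → K) : Prop :=
  ∃ P Q : Matrix (Fin d) (Fin d) K, P * Q = 1 ∧ Q * P = 1 ∧ A = P * Matrix.diagonal v * Q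

/-- `D` is the real diagonalizable part of `M`: the matrix `M` is a sum `D + S + N` of pairwise
commuting real matrices, with `D` diagonalizable over the reals, `S` diagonalizable over the
complex numbers with purely imaginary (possibly zero) eigenvalues, and `N` nilpotent. -/
def IsRealDiagonalizablePart {d : ℕ} (D M : Matrix (Fin d) (Fin d) ℝ) : Prop :=
  ∃ S N : Matrix (Fin d) (Fin d) ℝ,
    M = D + S + N ∧ Commute D S ∧ Commute D N ∧ Commute S N ∧
    (∃ v : Fin d → ℝ, IsDiagonalizableWith D v) ∧
    (∃ w : Fin d → ℂ, IsDiagonalizableWith (S.map (fun t : ℝ => (t : ℂ))) w ∧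
      ∀ i, (w i).re = 0) ∧
    IsNilpotent N

/-- A pseudo-norm on the Euclidean space which is homogeneous with respect to the dilations
`a ^ M`. -/
structure IsPseudoNorm {d : ℕ} (M : Matrix (Fin d) (Fin d) ℝ) (ρ : Space d → ℝ) : Prop where
  continuous : Continuous ρ
  homogeneous : ∀ a : ℝ, 0 < a → ∀ x, ρ (scale a M x) = a * ρ x
  pos : ∀ x, x ≠ 0 → 0 < ρ x

/-- `ψ` is an anisotropic Littlewood-Paley analysis with anisotropy `E`, where `ρ` is a
pseudo-norm for the transpose of `E`. -/
structure IsLittlewoodPaley {d : ℕ} (E : Matrix (Fin d) (Fin d) ℝ) (ρ : Space d → ℝ)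
    (ψ : ℕ → 𝓢(Space d, ℂ)) : Prop where
  eq_one : ∀ ξ, ρ ξ ≤ 1 → 𝓕 (ψ 0) ξ = 1
  eq_zero : ∀ ξ, 2 ≤ ρ ξ → 𝓕 (ψ 0) ξ = 0
  succ : ∀ (j : ℕ) (ξ), 𝓕 (ψ (j + 1)) ξ =
    𝓕 (ψ 0) (scale 2 (-((j : ℝ) + 1) • Eᵀ) ξ) - 𝓕 (ψ 0) (scale 2 (-(j : ℝ) • Eᵀ) ξ)

/-- The Schwartz function `y ↦ ψ (x - y)`. -/
def reflTranslate {d : ℕ} (ψ : 𝓢(Space d, ℂ)) (x : Space d) : 𝓢(Space d, ℂ) :=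
  SchwartzMap.compCLMOfAntilipschitz (K := 1) ℂ (g := fun y : Space d => x - y)
    (by fun_prop)
    (AntilipschitzWith.of_le_mul_dist fun a b => by
      rw [dist_eq_norm, dist_eq_norm, norm_sub_rev]; simp) ψ

theorem reflTranslate_apply {d : ℕ} (ψ : 𝓢(Space d, ℂ)) (x y : Space d) :
    reflTranslate ψ x y = ψ (x - y) := rfl

/-- The convolution of a tempered distribution and a Schwartz function, a function on the
Euclidean space. -/
def conv {d : ℕ} (u : 𝓢'(Space d, ℂ)) (ψ : 𝓢(Space d, ℂ)) (x : Space d) : ℂ :=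
  u (reflTranslate ψ x)

/-- The Besov (quasi-)norm of smoothness `s` of a tempered distribution, relative to a
Littlewood-Paley analysis `ψ`. It is the `ℓ^q` norm of the sequence
`2 ^ (j s) * ‖u * ψ_j‖_{L^p}`, a supremum for `q = ∞`, with values in `[0, ∞]`. -/
def besovNorm {d : ℕ} (ψ : ℕ → 𝓢(Space d, ℂ)) (s : ℝ) (p q : ℝ≥0∞) (u : 𝓢'(Space d, ℂ)) :
    ℝ≥0∞ :=
  if q = ⊤ then
    ⨆ j : ℕ, ENNReal.ofReal ((2 : ℝ) ^ ((j : ℝ) * s)) * eLpNorm (conv u (ψ j)) p volume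
  else
    (∑' j : ℕ, (ENNReal.ofReal ((2 : ℝ) ^ ((j : ℝ) * s)) *
      eLpNorm (conv u (ψ j)) p volume) ^ q.toReal) ^ (1 / q.toReal)

/-- The anisotropic Besov space, a set of tempered distributions. The anisotropy enters through
the Littlewood-Paley analysis `ψ`. -/
def besovSpace {d : ℕ} (ψ : ℕ → 𝓢(Space d, ℂ)) (s : ℝ) (p q : ℝ≥0∞) : Set 𝓢'(Space d, ℂ) :=
  {u | besovNorm ψ s p q u < ⊤}

/-- The tempered distribution `u` is given by integration against the function `g`. -/
def Represents {d : ℕ} (g : Space d → ℂ) (u : 𝓢'(Space d, ℂ)) : Prop :=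
  ∀ θ : 𝓢(Space d, ℂ), Integrable (fun x => g x * θ x) volume ∧ u θ = ∫ x, g x * θ x

/-- `f` is locally in `L^p`: it is in `L^p` on every compact set. -/
def LocallyLp {d : ℕ} (p : ℝ≥0∞) (f : Space d → ℂ) : Prop :=
  ∀ K : Set (Space d), IsCompact K → MemLp f p (volume.restrict K)

/-- The local anisotropic Besov space: `f` is locally in `L^p` and, for every smooth compactly
supported `φ`, the function `φ f` belongs to the anisotropic Besov space. -/
def besovLoc {d : ℕ} (ψ : ℕ → 𝓢(Space d, ℂ)) (s : ℝ) (p q : ℝ≥0∞) : Set (Space d → ℂ) :=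
  {f | LocallyLp p f ∧ ∀ φ : Space d → ℂ, ContDiff ℝ ((⊤ : ℕ∞) : WithTop ℕ∞) φ → HasCompactSupport φ →
    ∃ u ∈ besovSpace ψ s p q, Represents (fun x => φ x * f x) u}

/-- The anisotropic local critical exponent, the supremum of all `s > 0` such that `f` belongs to
the local anisotropic Besov space of smoothness `s`. It is an extended real number, equal to `+∞`
if all `s > 0` are allowed, and to `-∞` (the supremum of the empty set) if there is none. -/
def criticalExponent {d : ℕ} (ψ : ℕ → 𝓢(Space d, ℂ)) (p q : ℝ≥0∞) (f : Space d → ℂ) : EReal :=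
  sSup ((fun s : ℝ => (s : EReal)) '' {s : ℝ | 0 < s ∧ f ∈ besovLoc ψ s p q})

end AnisoBesov

end

/-! Write `E₁ = D + R₁` and `E₂ = D + R₂`, where each remainder `Rᵢ = Sᵢ + Nᵢ` commutes with `D`. In
`a^{E₁} a^{-E₂}` the powers of `D` cancel and `a^{R₁} a^{-R₂}` is left. Its norm is polynomial in
`|log a|`, since the imaginary part has bounded powers and the nilpotent part polynomial ones
(`exists_norm_exp_mul_exp_neg_le`).

At frequency scale `2^j` this is a power of `j`, hence at most a constant times `2^{δj}` for every
`δ > 0`. So `ρ₁ ξ ≤ 2^j` forces `ρ₂ ξ ≤ C 2^{(1+δ)j}` (`exists_le_of_two_pow_le`). The passage from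
matrices to pseudo-norms uses that the eigenvalues of `D` are positive: the dilations contract, so
pseudo-norm balls are bounded and pseudo-norms grow polynomially.

Consequently block `j` of the first analysis meets block `k` of the second only if `k ≤ (1+δ)j + C`.
Each block of the second analysis is reproduced by the blocks of the first that it meets, and
Young's inequality applies with kernels bounded uniformly in `L¹`. Decay `2^{-js}` thus becomes
decay `2^{-kσ}` for every `0 < σ < s` (`exists_eLpNorm_convolution_le`), and a further loss makes
the sequence geometric, so that `q` is immaterial. This gives `besovLoc_subset` with an arbitrarily
small loss of smoothness, which the supremum does not see. Exchanging the two anisotropies gives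
equality. -/

noncomputable section

namespace AnisoBesov

/-! ### Growth and decay of matrix exponentials. -/

section MatrixExponential

attribute [local instance] Matrix.linftyOpNormedRing Matrix.linftyOpNormedAlgebra

open Filter Topology

variable {d : ℕ}

/-- The complexification of real matrices, as a ring homomorphism. -/
abbrev complexify (d : ℕ) : Matrix (Fin d) (Fin d) ℝ →+* Matrix (Fin d) (Fin d) ℂ :=
  Complex.ofRealHom.mapMatrix

/-- Allows bounds proved after diagonalizing over `ℂ` to be used for real matrices. -/
theorem norm_complexify (A : Matrix (Fin d) (Fin d) ℝ) : ‖complexify d A‖ = ‖A‖ := by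
  simp [Matrix.linfty_opNorm_def]

theorem continuous_complexify : Continuous (complexify d) := by
  exact Continuous.matrix_map continuous_id Complex.continuous_ofReal

theorem complexify_exp (A : Matrix (Fin d) (Fin d) ℝ) :
    complexify d (NormedSpace.exp A) = NormedSpace.exp (complexify d A) := by
  let : NormedAlgebra ℚ (Matrix (Fin d) (Fin d) ℝ) :=
    NormedAlgebra.restrictScalars ℚ ℝ (Matrix (Fin d) (Fin d) ℝ)
  exact NormedSpace.map_exp _ continuous_complexify A

theorem complexify_smul (t : ℝ) (A : Matrix (Fin d) (Fin d) ℝ) :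
    complexify d (t • A) = (t : ℂ) • complexify d A := by
  ext i j
  simp

/-- The exponential of a diagonalizable matrix. -/
theorem exp_smul_of_isDiagonalizable {K : Type*} [RCLike K] {P Q : Matrix (Fin d) (Fin d) K}
    (hPQ : P * Q = 1) (hQP : Q * P = 1) (v : Fin d → K) (t : K) :
    NormedSpace.exp (t • (P * diagonal v * Q)) =
      P * diagonal (fun i => NormedSpace.exp (t * v i)) * Q := by
  have h := Matrix.exp_units_conj (⟨P, Q, hPQ, hQP⟩ : (Matrix (Fin d) (Fin d) K)ˣ)
    (t • diagonal v)
  have e : t • (P * diagonal v * Q) = P * (t • diagonal v) * Q := by simp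
  rw [e]
  refine h.trans ?_
  rw [← diagonal_smul, Matrix.exp_diagonal]
  congr 3
  ext i
  simp [Pi.coe_exp]

/-- The exponential series stops at the nilpotency index, so it is a polynomial in `t`. -/
theorem exists_norm_exp_smul_le_of_isNilpotent {N : Matrix (Fin d) (Fin d) ℝ}
    (hN : IsNilpotent N) :
    ∃ (C : ℝ) (m : ℕ), 0 ≤ C ∧ ∀ t : ℝ, ‖NormedSpace.exp (t • N)‖ ≤ C * (1 + |t|) ^ m := by
  obtain ⟨m, hm⟩ := hN
  refine ⟨∑ n ∈ Finset.range m, ‖N ^ n‖, m, by positivity, fun t => ?_⟩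
  have h : NormedSpace.exp (t • N) =
      ∑ n ∈ Finset.range m, ((n.factorial : ℝ)⁻¹ • (t • N) ^ n) := by
    rw [NormedSpace.exp_eq_tsum ℝ]
    refine tsum_eq_sum fun n hn => ?_
    have : N ^ n = 0 := pow_eq_zero_of_le (by simpa using hn) hm
    simp [smul_pow, this]
  rw [h, Finset.sum_mul]
  refine (norm_sum_le _ _).trans (Finset.sum_le_sum fun n hn => ?_)
  rw [smul_pow, norm_smul, norm_smul, norm_pow, Real.norm_eq_abs, Real.norm_eq_abs]
  have h1 : |((n.factorial : ℝ))⁻¹| ≤ 1 := by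
    rw [abs_of_nonneg (by positivity)]
    exact inv_le_one_of_one_le₀ (by exact_mod_cast Nat.one_le_of_lt n.factorial_pos)
  have h2 : |t| ^ n ≤ (1 + |t|) ^ m :=
    (pow_le_pow_left₀ (abs_nonneg t) (by linarith) n).trans
      (pow_le_pow_right₀ (by linarith [abs_nonneg t]) (by simpa using (Finset.mem_range.1 hn).le))
  calc |((n.factorial : ℝ))⁻¹| * (|t| ^ n * ‖N ^ n‖)
      ≤ 1 * ((1 + |t|) ^ m * ‖N ^ n‖) := by gcongr
    _ = ‖N ^ n‖ * (1 + |t|) ^ m := by ring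

/-- Over `ℂ` the exponential is conjugate, by a fixed matrix, to a diagonal matrix with entries of
modulus one. -/
theorem exists_norm_exp_smul_le_of_imaginary {S : Matrix (Fin d) (Fin d) ℝ} {w : Fin d → ℂ}
    (hS : IsDiagonalizableWith (S.map (fun t : ℝ => (t : ℂ))) w) (hw : ∀ i, (w i).re = 0) :
    ∃ C : ℝ, 0 ≤ C ∧ ∀ t : ℝ, ‖NormedSpace.exp (t • S)‖ ≤ C := by
  obtain ⟨P, Q, hPQ, hQP, h⟩ := hS
  refine ⟨‖P‖ * 1 * ‖Q‖, by positivity, fun t => ?_⟩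
  have h' : complexify d S = P * diagonal w * Q := h
  rw [← norm_complexify, complexify_exp, complexify_smul, h', exp_smul_of_isDiagonalizable hPQ hQP]
  refine (norm_mul_le _ _).trans ?_
  gcongr
  refine (norm_mul_le _ _).trans ?_
  gcongr
  rw [Matrix.linfty_opNorm_diagonal]
  refine (pi_norm_le_iff_of_nonneg zero_le_one).2 fun i => ?_
  rw [← Complex.exp_eq_exp_ℂ, Complex.norm_exp]
  simp [hw i]

/-- The exponential of the sum of the imaginary and the nilpotent part grows polynomially. -/
theorem exists_norm_exp_smul_add_le {S N : Matrix (Fin d) (Fin d) ℝ} {w : Fin d → ℂ}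
    (hSN : Commute S N) (hS : IsDiagonalizableWith (S.map (fun t : ℝ => (t : ℂ))) w)
    (hw : ∀ i, (w i).re = 0) (hN : IsNilpotent N) :
    ∃ (C : ℝ) (m : ℕ), 0 ≤ C ∧
      ∀ t : ℝ, ‖NormedSpace.exp (t • (S + N))‖ ≤ C * (1 + |t|) ^ m := by
  obtain ⟨C₁, hC₁, h₁⟩ := exists_norm_exp_smul_le_of_imaginary hS hw
  obtain ⟨C₂, m, hC₂, h₂⟩ := exists_norm_exp_smul_le_of_isNilpotent hN
  refine ⟨C₁ * C₂, m, by positivity, fun t => ?_⟩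
  rw [smul_add, Matrix.exp_add_of_commute _ _ ((hSN.smul_left t).smul_right t), mul_assoc]
  exact (norm_mul_le _ _).trans (mul_le_mul (h₁ t) (h₂ t) (norm_nonneg _) hC₁)

/-- The `c`-eigenspace of `D` is stable under `S`, so it contains an eigenvector `y` of `S`. The
last nonzero vector among `y, N y, N² y, ...` is killed by `N` and, by commutation, keeps the
eigenvalues of `y` under `D` and `S`. -/
theorem exists_eigenvector_of_commute {D S N P Q : Matrix (Fin d) (Fin d) ℂ} {w : Fin d → ℂ}
    (hDS : Commute D S) (hDN : Commute D N) (hSN : Commute S N) (hQP : Q * P = 1)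
    (hPQ : P * Q = 1) (hS : S = P * diagonal w * Q) (hN : IsNilpotent N) {c : ℂ} {x : Fin d → ℂ}
    (hx : x ≠ 0) (hDx : D *ᵥ x = c • x) :
    ∃ i, ∃ z : Fin d → ℂ, z ≠ 0 ∧ (D + S + N) *ᵥ z = (c + w i) • z := by
  let V : Submodule ℂ (Fin d → ℂ) := Module.End.eigenspace (Matrix.toLin' D) c
  have hV : ∀ y, y ∈ V ↔ D *ᵥ y = c • y := fun y => by
    rw [Module.End.mem_eigenspace_iff, Matrix.toLin'_apply]
  have hmap : ∀ y ∈ V, Matrix.toLin' S y ∈ V := fun y hy => by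
    rw [hV] at hy ⊢
    rw [Matrix.toLin'_apply, Matrix.mulVec_mulVec, hDS.eq, ← Matrix.mulVec_mulVec, hy,
      Matrix.mulVec_smul]
  have : Nontrivial V := ⟨⟨⟨x, (hV x).2 hDx⟩, 0, fun h => hx (congrArg Subtype.val h)⟩⟩
  obtain ⟨μ, hμ⟩ := Module.End.exists_eigenvalue ((Matrix.toLin' S).restrict hmap)
  obtain ⟨y, hy⟩ := hμ.exists_hasEigenvector
  have hy0 : (y : Fin d → ℂ) ≠ 0 := fun h => hy.2 (Subtype.ext h)
  have hDy : D *ᵥ (y : Fin d → ℂ) = c • (y : Fin d → ℂ) := (hV _).1 y.2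
  have hSy : S *ᵥ (y : Fin d → ℂ) = μ • (y : Fin d → ℂ) := by
    have := congrArg Subtype.val hy.apply_eq_smul
    simpa using this
  have hQy : Q *ᵥ (y : Fin d → ℂ) ≠ 0 := fun h => hy0 (by
    have := congrArg (P *ᵥ ·) h
    simpa [Matrix.mulVec_mulVec, hPQ] using this)
  obtain ⟨i, hi⟩ := Function.ne_iff.1 hQy
  have hμi : μ = w i := by
    have h1 : (diagonal w *ᵥ (Q *ᵥ (y : Fin d → ℂ))) = μ • (Q *ᵥ (y : Fin d → ℂ)) := by
      rw [← Matrix.mulVec_smul, ← hSy, hS, Matrix.mulVec_mulVec, Matrix.mulVec_mulVec]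
      simp only [← mul_assoc, hQP, one_mul]
    have h2 := congrFun h1 i
    rw [Matrix.mulVec_diagonal] at h2
    exact (mul_right_cancel₀ hi h2).symm
  have hex : ∃ n, (N ^ n) *ᵥ (y : Fin d → ℂ) = 0 := by
    obtain ⟨n, hn⟩ := hN
    exact ⟨n, by simp [hn]⟩
  classical
  have hn := Nat.find_spec hex
  have hn0 : Nat.find hex ≠ 0 := fun h => by
    rw [h] at hn
    exact hy0 (by simpa using hn)
  obtain ⟨k, hk⟩ := Nat.exists_eq_succ_of_ne_zero hn0
  have hz := Nat.find_min hex (m := k) (by omega)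
  refine ⟨i, (N ^ k) *ᵥ (y : Fin d → ℂ), hz, ?_⟩
  rw [hk, Nat.succ_eq_add_one, pow_succ', ← Matrix.mulVec_mulVec] at hn
  rw [Matrix.add_mulVec, Matrix.add_mulVec, hn, add_zero, Matrix.mulVec_mulVec,
    Matrix.mulVec_mulVec, (hDN.pow_right k).eq, (hSN.pow_right k).eq, ← Matrix.mulVec_mulVec,
    ← Matrix.mulVec_mulVec, hDy, hSy, Matrix.mulVec_smul, Matrix.mulVec_smul, hμi, add_smul]

/-- The eigenvalues of the real diagonalizable part of an anisotropy are positive. -/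
theorem IsAnisotropy.pos {D S N : Matrix (Fin d) (Fin d) ℝ} {w : Fin d → ℂ} {v : Fin d → ℝ}
    (hE : IsAnisotropy (D + S + N)) (hDS : Commute D S) (hDN : Commute D N) (hSN : Commute S N)
    (hD : IsDiagonalizableWith D v)
    (hS : IsDiagonalizableWith (S.map (fun t : ℝ => (t : ℂ))) w)
    (hw : ∀ i, (w i).re = 0) (hN : IsNilpotent N) (i : Fin d) : 0 < v i := by
  obtain ⟨P, Q, hPQ, hQP, hD⟩ := hD
  obtain ⟨P', Q', hPQ', hQP', hS⟩ := hS
  have hDP : complexify d D * complexify d P = complexify d P * diagonal (fun i => (v i : ℂ)) := by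
    have h1 : D * P = P * diagonal v := by rw [hD, mul_assoc, hQP, mul_one]
    have h2 := congrArg (complexify d) h1
    rw [map_mul, map_mul] at h2
    rw [h2]
    congr 1
    ext a b
    by_cases hab : a = b <;> simp [hab]
  have hx : complexify d P *ᵥ Pi.single i 1 ≠ 0 := fun h => by
    have h1 := congrArg (complexify d Q *ᵥ ·) h
    simp only [Matrix.mulVec_mulVec, ← map_mul, hQP, map_one, Matrix.one_mulVec,
      Matrix.mulVec_zero] at h1
    have h2 := congrFun h1 i
    simp at h2
  have hDx : complexify d D *ᵥ (complexify d P *ᵥ Pi.single i 1) =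
      (v i : ℂ) • (complexify d P *ᵥ Pi.single i 1) := by
    rw [Matrix.mulVec_mulVec, hDP, ← Matrix.mulVec_mulVec, ← Matrix.mulVec_smul]
    congr 1
    ext a
    rw [Matrix.mulVec_diagonal]
    by_cases h : a = i
    · subst h; simp
    · simp [h]
  obtain ⟨j, z, hz, hEz⟩ := exists_eigenvector_of_commute (hDS.map (complexify d))
    (hDN.map (complexify d)) (hSN.map (complexify d)) hQP' hPQ' hS (hN.map (complexify d)) hx hDx
  have hmem : ((v i : ℂ) + w j) ∈ spectrum ℂ ((D + S + N).map (fun t : ℝ => (t : ℂ))) := by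
    rw [← Matrix.spectrum_toLin']
    refine Module.End.HasEigenvalue.mem_spectrum
      (Module.End.hasEigenvalue_of_hasEigenvector (x := z) ⟨?_, hz⟩)
    rw [Module.End.mem_eigenspace_iff, Matrix.toLin'_apply, ← hEz, ← map_add, ← map_add]
    rfl
  simpa [hw j] using hE _ hmem

theorem tendsto_one_add_pow_mul_exp_neg (m : ℕ) {c : ℝ} (hc : 0 < c) :
    Tendsto (fun t : ℝ => (1 + |t|) ^ m * Real.exp (-t * c)) atTop (𝓝 0) := by
  have h := (isLittleO_pow_exp_pos_mul_atTop (k := m) hc).tendsto_div_nhds_zero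
  have h2 := h.const_mul ((2 : ℝ) ^ m)
  rw [mul_zero] at h2
  refine squeeze_zero' (Eventually.of_forall fun t => by positivity) ?_ h2
  filter_upwards [eventually_ge_atTop (1 : ℝ)] with t ht
  rw [show -t * c = -(c * t) by ring, Real.exp_neg, ← div_eq_mul_inv, ← mul_div_assoc, ← mul_pow,
    abs_of_nonneg (by linarith)]
  gcongr
  linarith

/-- The negative powers of an anisotropy contract to zero. -/
theorem tendsto_exp_neg_smul {D E : Matrix (Fin d) (Fin d) ℝ} (hE : IsAnisotropy E)
    (hD : IsRealDiagonalizablePart D E) :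
    Tendsto (fun t : ℝ => ‖NormedSpace.exp ((-t) • E)‖) atTop (𝓝 0) := by
  obtain ⟨S, N, rfl, hDS, hDN, hSN, ⟨v, hv⟩, ⟨w, hS, hw⟩, hN⟩ := hD
  have hpos := hE.pos hDS hDN hSN hv hS hw hN
  obtain ⟨C, m, hC, hR⟩ := exists_norm_exp_smul_add_le hSN hS hw hN
  obtain ⟨P, Q, hPQ, hQP, rfl⟩ := hv
  -- Summing over all eigenvalues avoids selecting the smallest one and covers `d = 0`.
  have hlim : Tendsto (fun t : ℝ =>
      ∑ i, ‖P‖ * ‖Q‖ * C * ((1 + |t|) ^ m * Real.exp (-t * v i))) atTop (𝓝 0) := by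
    have := tendsto_finsetSum Finset.univ (fun i _ =>
      (tendsto_one_add_pow_mul_exp_neg m (hpos i)).const_mul (‖P‖ * ‖Q‖ * C))
    simpa using this
  refine squeeze_zero (fun t => norm_nonneg _) (fun t => ?_) hlim
  have hcomm : Commute ((-t) • (P * diagonal v * Q)) ((-t) • (S + N)) :=
    ((hDS.add_right hDN).smul_left _).smul_right _
  rw [add_assoc, smul_add, Matrix.exp_add_of_commute _ _ hcomm,
    exp_smul_of_isDiagonalizable hPQ hQP]
  have hdiag : ‖diagonal (fun i => NormedSpace.exp (-t * v i))‖ ≤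
      ∑ i, Real.exp (-t * v i) := by
    rw [Matrix.linfty_opNorm_diagonal]
    refine (pi_norm_le_iff_of_nonneg (by positivity)).2 fun i => ?_
    rw [← Real.exp_eq_exp_ℝ, Real.norm_eq_abs, Real.abs_exp]
    exact Finset.single_le_sum (f := fun i => Real.exp (-t * v i))
      (fun j _ => (Real.exp_pos _).le) (Finset.mem_univ i)
  calc ‖P * diagonal (fun i => NormedSpace.exp (-t * v i)) * Q * NormedSpace.exp ((-t) • (S + N))‖
      ≤ ‖P‖ * ‖diagonal (fun i => NormedSpace.exp (-t * v i))‖ * ‖Q‖ *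
          ‖NormedSpace.exp ((-t) • (S + N))‖ := by
        refine (norm_mul_le _ _).trans ?_
        gcongr
        refine (norm_mul_le _ _).trans ?_
        gcongr
        exact norm_mul_le _ _
    _ ≤ ‖P‖ * (∑ i, Real.exp (-t * v i)) * ‖Q‖ * (C * (1 + |-t|) ^ m) := by
        gcongr
        exact hR (-t)
    _ = _ := by
        rw [abs_neg, Finset.mul_sum, Finset.sum_mul, Finset.sum_mul]
        exact Finset.sum_congr rfl fun i _ => by ring

/-- The powers of two anisotropies with the same real diagonalizable part agree up to polynomial
factors of the logarithm. -/
theorem exists_norm_exp_mul_exp_neg_le {D E₁ E₂ : Matrix (Fin d) (Fin d) ℝ}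
    (hD₁ : IsRealDiagonalizablePart D E₁) (hD₂ : IsRealDiagonalizablePart D E₂) :
    ∃ (C : ℝ) (m : ℕ), 0 ≤ C ∧ ∀ t : ℝ,
      ‖NormedSpace.exp (t • E₁) * NormedSpace.exp ((-t) • E₂)‖ ≤ C * (1 + |t|) ^ m := by
  obtain ⟨S₁, N₁, rfl, hDS₁, hDN₁, hSN₁, -, ⟨w₁, hS₁, hw₁⟩, hN₁⟩ := hD₁
  obtain ⟨S₂, N₂, rfl, hDS₂, hDN₂, hSN₂, -, ⟨w₂, hS₂, hw₂⟩, hN₂⟩ := hD₂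
  obtain ⟨C₁, m₁, hC₁, h₁⟩ := exists_norm_exp_smul_add_le hSN₁ hS₁ hw₁ hN₁
  obtain ⟨C₂, m₂, hC₂, h₂⟩ := exists_norm_exp_smul_add_le hSN₂ hS₂ hw₂ hN₂
  refine ⟨C₁ * C₂, m₁ + m₂, by positivity, fun t => ?_⟩
  have c₁ : Commute (t • (S₁ + N₁)) (t • D) :=
    (((hDS₁.add_right hDN₁).symm).smul_left _).smul_right _
  have c₂ : Commute ((-t) • D) ((-t) • (S₂ + N₂)) :=
    ((hDS₂.add_right hDN₂).smul_left _).smul_right _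
  have c₃ : Commute (t • D) ((-t) • D) := ((Commute.refl D).smul_left _).smul_right _
  -- The two remainders need not commute with each other. The factors are ordered so that the
  -- exponentials of `D` become adjacent and cancel.
  have e₁ : D + S₁ + N₁ = (S₁ + N₁) + D := by abel
  have e₂ : D + S₂ + N₂ = D + (S₂ + N₂) := by abel
  have e₃ : NormedSpace.exp (t • D) * NormedSpace.exp ((-t) • D) = 1 := by
    rw [← Matrix.exp_add_of_commute _ _ c₃, ← add_smul, add_neg_cancel, zero_smul,
      NormedSpace.exp_zero]
  rw [e₁, e₂, smul_add t (S₁ + N₁), smul_add (-t) D, Matrix.exp_add_of_commute _ _ c₁,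
    Matrix.exp_add_of_commute _ _ c₂, mul_assoc, ← mul_assoc (NormedSpace.exp (t • D)), e₃,
    one_mul]
  calc ‖NormedSpace.exp (t • (S₁ + N₁)) * NormedSpace.exp ((-t) • (S₂ + N₂))‖
      ≤ (C₁ * (1 + |t|) ^ m₁) * (C₂ * (1 + |-t|) ^ m₂) :=
        (norm_mul_le _ _).trans (mul_le_mul (h₁ t) (h₂ (-t)) (norm_nonneg _) (by positivity))
    _ = _ := by rw [abs_neg, pow_add]; ring

end MatrixExponential

/-! ### Anisotropic dilations of Euclidean space. -/

section Dilations

attribute [local instance] Matrix.linftyOpNormedRing Matrix.linftyOpNormedAlgebra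

open Filter Topology

variable {d : ℕ}

theorem matPow_mul_matPow {a b : ℝ} (ha : 0 < a) (hb : 0 < b) (M : Matrix (Fin d) (Fin d) ℝ) :
    matPow a M * matPow b M = matPow (a * b) M := by
  have hc : Commute (Real.log a • M) (Real.log b • M) :=
    ((Commute.refl M).smul_left _).smul_right _
  rw [matPow, matPow, matPow, Real.log_mul ha.ne' hb.ne', add_smul,
    Matrix.exp_add_of_commute _ _ hc]

theorem matPow_one (M : Matrix (Fin d) (Fin d) ℝ) : matPow 1 M = 1 := by
  rw [matPow, Real.log_one, zero_smul, NormedSpace.exp_zero]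

theorem matPow_rpow {a : ℝ} (ha : 0 < a) (r : ℝ) (M : Matrix (Fin d) (Fin d) ℝ) :
    matPow (a ^ r) M = matPow a (r • M) := by
  rw [matPow, matPow, Real.log_rpow ha, smul_smul, mul_comm]

theorem matPow_transpose (a : ℝ) (M : Matrix (Fin d) (Fin d) ℝ) :
    matPow a Mᵀ = (matPow a M)ᵀ := by
  rw [matPow, matPow, ← Matrix.exp_transpose, Matrix.transpose_smul]

theorem toEuclideanLin_mul (A B : Matrix (Fin d) (Fin d) ℝ) (x : Space d) :
    Matrix.toEuclideanLin (A * B) x = Matrix.toEuclideanLin A (Matrix.toEuclideanLin B x) := by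
  simp

theorem toEuclideanLin_one (x : Space d) :
    Matrix.toEuclideanLin (1 : Matrix (Fin d) (Fin d) ℝ) x = x := by
  simp

theorem scale_scale {a b : ℝ} (ha : 0 < a) (hb : 0 < b) (M : Matrix (Fin d) (Fin d) ℝ)
    (x : Space d) : scale a M (scale b M x) = scale (a * b) M x := by
  rw [scale, scale, scale, ← toEuclideanLin_mul, matPow_mul_matPow ha hb]

theorem scale_one (M : Matrix (Fin d) (Fin d) ℝ) (x : Space d) : scale 1 M x = x := by
  rw [scale, matPow_one, toEuclideanLin_one]

theorem scale_inv_scale {a : ℝ} (ha : 0 < a) (M : Matrix (Fin d) (Fin d) ℝ) (x : Space d) :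
    scale a⁻¹ M (scale a M x) = x := by
  rw [scale_scale (inv_pos.2 ha) ha, inv_mul_cancel₀ ha.ne', scale_one]

theorem scale_scale_inv {a : ℝ} (ha : 0 < a) (M : Matrix (Fin d) (Fin d) ℝ) (x : Space d) :
    scale a M (scale a⁻¹ M x) = x := by
  rw [scale_scale ha (inv_pos.2 ha), mul_inv_cancel₀ ha.ne', scale_one]

theorem scale_rpow {a : ℝ} (ha : 0 < a) (r : ℝ) (M : Matrix (Fin d) (Fin d) ℝ) (x : Space d) :
    scale (a ^ r) M x = scale a (r • M) x := by
  rw [scale, scale, matPow_rpow ha]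

theorem continuous_scale (M : Matrix (Fin d) (Fin d) ℝ) (x : Space d) :
    ContinuousOn (fun a => scale a M x) (Set.Ioi 0) := by
  have h1 : ContinuousOn (fun a => matPow a M) (Set.Ioi 0) := by
    let : NormedAlgebra ℚ (Matrix (Fin d) (Fin d) ℝ) :=
      NormedAlgebra.restrictScalars ℚ ℝ (Matrix (Fin d) (Fin d) ℝ)
    refine (NormedSpace.exp_continuous (𝔸 := Matrix (Fin d) (Fin d) ℝ)).comp_continuousOn ?_
    exact ContinuousOn.smul (Real.continuousOn_log.mono fun a ha => ne_of_gt ha)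
      continuousOn_const
  have h2 : Continuous fun A : Matrix (Fin d) (Fin d) ℝ => Matrix.toEuclideanLin A x := by
    simp only [Matrix.toLpLin_apply]
    fun_prop
  exact h2.comp_continuousOn h1

theorem norm_apply_le_linfty_opNorm (A : Matrix (Fin d) (Fin d) ℝ) (i j : Fin d) :
    ‖A i j‖ ≤ ‖A‖ := by
  have h := (norm_le_pi_norm (A *ᵥ Pi.single j 1) i).trans (linfty_opNorm_mulVec A _)
  simpa [Pi.norm_single] using h

/-- Only dependence on `d` matters, so the entries are estimated crudely. The transpose is there
because frequencies are dilated by `Eᵀ` while the exponential bounds concern `E`. -/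
theorem exists_norm_toEuclideanLin_transpose_le (d : ℕ) :
    ∃ K : ℝ, 0 ≤ K ∧ ∀ (A : Matrix (Fin d) (Fin d) ℝ) (x : Space d),
      ‖Matrix.toEuclideanLin Aᵀ x‖ ≤ K * ‖A‖ * ‖x‖ := by
  refine ⟨d * d, by positivity, fun A x => ?_⟩
  have hentry : ∀ i, ‖(Matrix.toEuclideanLin Aᵀ x) i‖ ≤ d * (‖A‖ * ‖x‖) := fun i => by
    simp only [Matrix.toLpLin_apply, Matrix.mulVec, dotProduct]
    refine (norm_sum_le _ _).trans ((Finset.sum_le_card_nsmul _ _ (‖A‖ * ‖x‖) ?_).trans (by simp))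
    intro j _
    rw [norm_mul]
    exact mul_le_mul (norm_apply_le_linfty_opNorm A j i) (PiLp.norm_apply_le x j) (norm_nonneg _)
      (norm_nonneg _)
  rw [← (EuclideanSpace.basisFun (Fin d) ℝ).sum_repr (Matrix.toEuclideanLin Aᵀ x)]
  refine (norm_sum_le _ _).trans ((Finset.sum_le_card_nsmul _ _ (d * (‖A‖ * ‖x‖)) ?_).trans ?_)
  · intro i _
    simpa [norm_smul] using hentry i
  · simp only [Finset.card_univ, Fintype.card_fin, nsmul_eq_mul]
    exact le_of_eq (by ring)

/-- The dilations of small ratio contract the space. -/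
def IsContracting (M : Matrix (Fin d) (Fin d) ℝ) : Prop :=
  ∃ c : ℝ → ℝ, (∀ a, 0 ≤ c a) ∧ Tendsto c (𝓝[>] 0) (𝓝 0) ∧
    ∀ a x, ‖scale a M x‖ ≤ c a * ‖x‖

theorem IsAnisotropy.isContracting_transpose {D E : Matrix (Fin d) (Fin d) ℝ}
    (hE : IsAnisotropy E) (hD : IsRealDiagonalizablePart D E) : IsContracting Eᵀ := by
  obtain ⟨K, hK, h⟩ := exists_norm_toEuclideanLin_transpose_le d
  refine ⟨fun a => K * ‖matPow a E‖, fun a => mul_nonneg hK (norm_nonneg _), ?_, fun a x => ?_⟩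
  · have h1 := (tendsto_exp_neg_smul hE hD).comp
      (tendsto_neg_atBot_atTop.comp Real.tendsto_log_nhdsGT_zero)
    have h2 := h1.const_mul K
    simpa [Function.comp_def, matPow] using h2
  · rw [scale, matPow_transpose]
    exact h _ _

theorem exists_norm_scale_inv_scale_le {D E₁ E₂ : Matrix (Fin d) (Fin d) ℝ}
    (hD₁ : IsRealDiagonalizablePart D E₁) (hD₂ : IsRealDiagonalizablePart D E₂) :
    ∃ (C : ℝ) (m : ℕ), 0 ≤ C ∧ ∀ (j : ℕ) (x : Space d),
      ‖scale ((2 : ℝ) ^ j)⁻¹ E₂ᵀ (scale ((2 : ℝ) ^ j) E₁ᵀ x)‖ ≤ C * (1 + j) ^ m * ‖x‖ := by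
  obtain ⟨K, hK, h⟩ := exists_norm_toEuclideanLin_transpose_le d
  obtain ⟨C, m, hC, h'⟩ := exists_norm_exp_mul_exp_neg_le hD₁ hD₂
  refine ⟨K * C, m, by positivity, fun j x => ?_⟩
  rw [scale, scale, ← toEuclideanLin_mul, matPow_transpose, matPow_transpose,
    ← Matrix.transpose_mul]
  refine (h _ _).trans ?_
  rw [mul_assoc K C]
  gcongr
  have hlog : Real.log ((2 : ℝ) ^ j) = j * Real.log 2 := by rw [Real.log_pow]
  rw [matPow, matPow, Real.log_inv]
  refine (h' _).trans ?_
  rw [hlog, abs_of_nonneg (by positivity)]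
  gcongr
  have := Real.log_two_lt_d9
  exact mul_le_of_le_one_right (by positivity) (by linarith)

end Dilations

/-! ### Size and comparison of pseudo-norms. -/

section PseudoNorm

open Filter Topology

variable {d : ℕ} {M : Matrix (Fin d) (Fin d) ℝ} {ρ : Space d → ℝ}

theorem IsPseudoNorm.nonneg (hρ : IsPseudoNorm M ρ) (x : Space d) : 0 ≤ ρ x := by
  by_cases hx : x = 0
  · have h := hρ.homogeneous 2 two_pos 0
    have h0 : scale 2 M (0 : Space d) = 0 := by simp [scale]
    rw [h0] at h
    rw [hx]
    linarith
  · exact (hρ.pos x hx).le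

/-- A point outside the unit ball is moved onto the unit sphere by a dilation of ratio `b ≤ 1`, by
continuity along its orbit. There `ρ` has a positive minimum, and homogeneity only increases it on
the way back. -/
theorem IsPseudoNorm.exists_pos_le (hM : IsContracting M) (hρ : IsPseudoNorm M ρ) :
    ∃ c : ℝ, 0 < c ∧ ∀ x : Space d, 1 ≤ ‖x‖ → c ≤ ρ x := by
  obtain ⟨c₀, hc₀, h₀⟩ : ∃ c₀ : ℝ, 0 < c₀ ∧ ∀ y ∈ Metric.sphere (0 : Space d) 1, c₀ ≤ ρ y := by
    rcases (Metric.sphere (0 : Space d) 1).eq_empty_or_nonempty with h | h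
    · exact ⟨1, one_pos, by simp [h]⟩
    · obtain ⟨y, hy, hmin⟩ := (isCompact_sphere (0 : Space d) 1).exists_isMinOn h
        hρ.continuous.continuousOn
      exact ⟨ρ y, hρ.pos y (ne_zero_of_mem_unit_sphere ⟨y, hy⟩), fun z hz => hmin hz⟩
  refine ⟨c₀, hc₀, fun x hx => ?_⟩
  obtain ⟨c, hc0, hc, hcx⟩ := hM
  have hlim : Tendsto (fun a => c a * ‖x‖) (𝓝[>] 0) (𝓝 0) := by simpa using hc.mul_const ‖x‖
  obtain ⟨a, ha1, ha, hapos⟩ := ((hlim.eventually (gt_mem_nhds one_pos)).and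
    (Ioo_mem_nhdsGT (one_pos : (0 : ℝ) < 1))).exists
  have hcont : ContinuousOn (fun a => ‖scale a M x‖) (Set.Icc a 1) :=
    ((continuous_scale M x).mono fun b hb => lt_of_lt_of_le ha hb.1).norm
  obtain ⟨b, hb, hb1⟩ := intermediate_value_Icc hapos.le hcont
    (show (1 : ℝ) ∈ _ from ⟨(hcx a x).trans ha1.le, by simpa [scale_one] using hx⟩)
  have hbpos : 0 < b := lt_of_lt_of_le ha hb.1
  have h1 : c₀ ≤ b * ρ x := by
    rw [← hρ.homogeneous b hbpos]
    exact h₀ _ (by simpa using hb1)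
  exact h1.trans (mul_le_of_le_one_left (hρ.nonneg x) hb.2)

/-- The unit ball of a pseudo-norm is bounded. -/
theorem IsPseudoNorm.exists_norm_le (hM : IsContracting M) (hρ : IsPseudoNorm M ρ) :
    ∃ R : ℝ, 0 ≤ R ∧ ∀ x : Space d, ρ x ≤ 1 → ‖x‖ ≤ R := by
  obtain ⟨c₀, hc₀, h₀⟩ := hρ.exists_pos_le hM
  obtain ⟨c, hc0, -, hcx⟩ := hM
  -- Dilating by `c₀ / 2` brings `ρ x ≤ 1` strictly below `c₀`, hence the point into the unit ball.
  have hb : 0 < c₀ / 2 := by positivity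
  refine ⟨c (c₀ / 2)⁻¹, hc0 _, fun x hx => ?_⟩
  have h1 : ‖scale (c₀ / 2) M x‖ < 1 := by
    by_contra! h
    have h2 := h₀ _ h
    rw [hρ.homogeneous _ hb] at h2
    nlinarith
  calc ‖x‖ = ‖scale (c₀ / 2)⁻¹ M (scale (c₀ / 2) M x)‖ := by rw [scale_inv_scale hb]
    _ ≤ c (c₀ / 2)⁻¹ * ‖scale (c₀ / 2) M x‖ := hcx _ _
    _ ≤ c (c₀ / 2)⁻¹ := mul_le_of_le_one_right (hc0 _) h1.le

/-- A pseudo-norm has polynomial growth. -/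
theorem IsPseudoNorm.exists_le_pow (hM : IsContracting M) (hρ : IsPseudoNorm M ρ) :
    ∃ (C : ℝ) (m : ℕ), 0 ≤ C ∧ ∀ x : Space d, ρ x ≤ C * (1 + ‖x‖) ^ m := by
  obtain ⟨B, hB⟩ := (isCompact_closedBall (0 : Space d) 1).bddAbove_image
    hρ.continuous.continuousOn
  have hB' : ∀ x : Space d, ‖x‖ ≤ 1 → ρ x ≤ B := fun x hx =>
    hB (Set.mem_image_of_mem _ (by simpa using hx))
  have hB0 : 0 ≤ B := (hρ.nonneg 0).trans (hB' 0 (by simp))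
  obtain ⟨c, hc0, hc, hcx⟩ := hM
  obtain ⟨b, hb1, hb, -⟩ := ((hc.eventually (gt_mem_nhds (half_pos one_pos))).and
    (Ioo_mem_nhdsGT (one_pos : (0 : ℝ) < 1))).exists
  -- The dilation by `b` at least halves the norm and multiplies `ρ` by `b > 2^{-m}`. So doubling
  -- the radius costs a factor of at most `2^m`.
  obtain ⟨m, hm⟩ := pow_unbounded_of_one_lt b⁻¹ (one_lt_two (α := ℝ))
  have hiter : ∀ (n : ℕ) (x : Space d), ‖x‖ ≤ 2 ^ n → ρ x ≤ (2 ^ m) ^ n * B := by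
    intro n
    induction n with
    | zero => intro x hx; simpa using hB' x (by simpa using hx)
    | succ n ih =>
      intro x hx
      have h1 : ‖scale b M x‖ ≤ 2 ^ n := by
        refine (hcx b x).trans ?_
        calc c b * ‖x‖ ≤ 1 / 2 * 2 ^ (n + 1) := by gcongr
          _ = 2 ^ n := by ring
      have h2 := ih _ h1
      rw [hρ.homogeneous b hb] at h2
      calc ρ x = b⁻¹ * (b * ρ x) := by field_simp
        _ ≤ 2 ^ m * ((2 ^ m) ^ n * B) :=
          mul_le_mul hm.le h2 (mul_nonneg hb.le (hρ.nonneg x)) (by positivity)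
        _ = _ := by ring
  refine ⟨2 ^ m * B, m, by positivity, fun x => ?_⟩
  obtain ⟨n, hn1, hn2⟩ := exists_nat_pow_near (show (1 : ℝ) ≤ 1 + ‖x‖ by simp) one_lt_two
  calc ρ x ≤ (2 ^ m) ^ (n + 1) * B := hiter (n + 1) x (by linarith)
    _ = 2 ^ m * B * (2 ^ n) ^ m := by ring
    _ ≤ _ := by gcongr

/-- Two pseudo-norms for anisotropies with the same real diagonalizable part are comparable up to
an arbitrarily small loss in the exponent. -/
theorem exists_le_of_two_pow_le {D E₁ E₂ : Matrix (Fin d) (Fin d) ℝ}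
    (hE₁ : IsAnisotropy E₁) (hE₂ : IsAnisotropy E₂)
    (hD₁ : IsRealDiagonalizablePart D E₁) (hD₂ : IsRealDiagonalizablePart D E₂)
    {ρ₁ ρ₂ : Space d → ℝ} (hρ₁ : IsPseudoNorm E₁ᵀ ρ₁) (hρ₂ : IsPseudoNorm E₂ᵀ ρ₂)
    {δ : ℝ} (hδ : 0 < δ) :
    ∃ C : ℝ, 0 ≤ C ∧ ∀ (j k : ℕ) (ξ : Space d), 2 ^ k ≤ ρ₂ ξ → ρ₁ ξ ≤ 2 ^ j →
      (k : ℝ) ≤ (1 + δ) * j + C := by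
  obtain ⟨R, hR, h₁⟩ := hρ₁.exists_norm_le (hE₁.isContracting_transpose hD₁)
  obtain ⟨A, n, hA, h₂⟩ := hρ₂.exists_le_pow (hE₂.isContracting_transpose hD₂)
  obtain ⟨B, m, hB, h₃⟩ := exists_norm_scale_inv_scale_le hD₁ hD₂
  have hlog : 0 < Real.log 2 := Real.log_pos one_lt_two
  -- `G` absorbs the power of `j` into `exp (j δ log 2) = 2^{δj}`.
  obtain ⟨G, hG⟩ := ((tendsto_one_add_pow_mul_exp_neg (m * n) (mul_pos hδ hlog)).comp
    tendsto_natCast_atTop_atTop).bddAbove_range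
  have hG' : ∀ j : ℕ, (1 + (j : ℝ)) ^ (m * n) ≤ G * Real.exp (j * (δ * Real.log 2)) := fun j => by
    have h : (1 + |(j : ℝ)|) ^ (m * n) * Real.exp (-j * (δ * Real.log 2)) ≤ G := hG ⟨j, rfl⟩
    rw [abs_of_nonneg (Nat.cast_nonneg j), neg_mul, Real.exp_neg, ← div_eq_mul_inv,
      div_le_iff₀ (Real.exp_pos _)] at h
    exact h
  have hG0 : 0 < G := by
    have := hG' 0
    simp at this
    linarith
  -- The added `1` gives `log L ≥ 0`, hence a nonnegative final constant.
  set L : ℝ := A * (1 + B * R) ^ n * G + 1 with hL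
  have hL1 : 1 ≤ L := by
    have : 0 ≤ A * (1 + B * R) ^ n * G := by positivity
    linarith
  refine ⟨Real.log L / Real.log 2, div_nonneg (Real.log_nonneg hL1) hlog.le,
    fun j k ξ hk hj => ?_⟩
  have h2j : (0 : ℝ) < 2 ^ j := by positivity
  have hη : ‖scale ((2 : ℝ) ^ j)⁻¹ E₁ᵀ ξ‖ ≤ R := by
    refine h₁ _ ?_
    rw [hρ₁.homogeneous _ (inv_pos.2 h2j), inv_mul_le_iff₀ h2j, mul_one]
    exact hj
  have hζ : ‖scale ((2 : ℝ) ^ j)⁻¹ E₂ᵀ ξ‖ ≤ B * (1 + j) ^ m * R := by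
    have := h₃ j (scale ((2 : ℝ) ^ j)⁻¹ E₁ᵀ ξ)
    rw [scale_scale_inv h2j] at this
    exact this.trans (by gcongr)
  have hmain : ρ₂ ξ ≤ 2 ^ j * (L * Real.exp (j * (δ * Real.log 2))) := by
    have e : ρ₂ ξ = 2 ^ j * ρ₂ (scale ((2 : ℝ) ^ j)⁻¹ E₂ᵀ ξ) := by
      rw [hρ₂.homogeneous _ (inv_pos.2 h2j)]
      field_simp
    rw [e]
    gcongr
    have hone : (1 : ℝ) ≤ (1 + (j : ℝ)) ^ m := one_le_pow₀ (by simp)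
    calc ρ₂ (scale ((2 : ℝ) ^ j)⁻¹ E₂ᵀ ξ)
        ≤ A * (1 + ‖scale ((2 : ℝ) ^ j)⁻¹ E₂ᵀ ξ‖) ^ n := h₂ _
      _ ≤ A * ((1 + B * R) * (1 + j) ^ m) ^ n := by
          gcongr
          calc 1 + ‖scale ((2 : ℝ) ^ j)⁻¹ E₂ᵀ ξ‖ ≤ (1 + j) ^ m + B * (1 + j) ^ m * R := by gcongr
            _ = _ := by ring
      _ = A * (1 + B * R) ^ n * (1 + j) ^ (m * n) := by rw [mul_pow, ← pow_mul]; ring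
      _ ≤ A * (1 + B * R) ^ n * (G * Real.exp (j * (δ * Real.log 2))) := by
          gcongr
          exact hG' j
      _ ≤ L * Real.exp (j * (δ * Real.log 2)) := by
          rw [← mul_assoc]
          gcongr
          rw [hL]
          linarith
  have h := Real.log_le_log (by positivity) (hk.trans hmain)
  rw [Real.log_pow, Real.log_mul h2j.ne' (by positivity), Real.log_mul (by positivity)
    (Real.exp_pos _).ne', Real.log_exp, Real.log_pow] at h
  rw [← mul_le_mul_iff_left₀ hlog, add_mul, div_mul_cancel₀ _ hlog.ne']
  linarith

end PseudoNorm

/-! ### Young's inequality. -/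

section Young

open scoped Convolution

variable {G : Type*} [AddCommGroup G] [MeasurableSpace G] [MeasurableAdd₂ G] [MeasurableNeg G]
  {μ : Measure G} [SFinite μ] [μ.IsAddLeftInvariant] [μ.IsNegInvariant]

/-- Hölder's inequality for the splitting `f k = (f k^{1/r}) · k^{1/r'}`, with `r'` conjugate to
`r`. -/
theorem lintegral_mul_rpow_le {α : Type*} [MeasurableSpace α] {μ : Measure α} {f k : α → ℝ≥0∞}
    (hf : AEMeasurable f μ) (hk : AEMeasurable k μ) {r : ℝ} (hr : 1 ≤ r) :
    (∫⁻ t, f t * k t ∂μ) ^ r ≤ (∫⁻ t, f t ^ r * k t ∂μ) * (∫⁻ t, k t ∂μ) ^ (r - 1) := by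
  rcases hr.eq_or_lt with rfl | hr
  · simp
  have hr0 : 0 < r := by linarith
  have hc : r.HolderConjugate (r / (r - 1)) := Real.HolderConjugate.conjExponent hr
  have h := ENNReal.lintegral_mul_le_Lp_mul_Lq μ hc
    (hf.mul (hk.pow_const (1 / r))) (hk.pow_const (1 / (r / (r - 1))))
  have e1 : ∀ t, ((f * fun t => k t ^ (1 / r)) * fun t => k t ^ (1 / (r / (r - 1)))) t =
      f t * k t := fun t => by
    simp only [Pi.mul_apply, mul_assoc]
    rw [← ENNReal.rpow_add_of_nonneg _ _ (by positivity)
      (div_nonneg zero_le_one hc.symm.nonneg)]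
    have : 1 / r + 1 / (r / (r - 1)) = 1 := by
      have := hc.inv_add_inv_eq_one
      simpa [one_div] using this
    rw [this, ENNReal.rpow_one]
  have e2 : ∀ t, (f * fun t => k t ^ (1 / r)) t ^ r = f t ^ r * k t := fun t => by
    rw [Pi.mul_apply, ENNReal.mul_rpow_of_nonneg _ _ hr0.le, ← ENNReal.rpow_mul,
      one_div_mul_cancel hr0.ne', ENNReal.rpow_one]
  have e3 : ∀ t, (k t ^ (1 / (r / (r - 1)))) ^ (r / (r - 1)) = k t := fun t => by
    rw [← ENNReal.rpow_mul, one_div_mul_cancel hc.symm.ne_zero, ENNReal.rpow_one]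
  simp only [e1, e2, e3] at h
  refine (ENNReal.rpow_le_rpow h hr0.le).trans (le_of_eq ?_)
  rw [ENNReal.mul_rpow_of_nonneg _ _ hr0.le, ← ENNReal.rpow_mul, ← ENNReal.rpow_mul,
    one_div_mul_cancel hr0.ne', ENNReal.rpow_one]
  congr 2
  field_simp

/-- **Young's convolution inequality** for a kernel in `L¹`. -/
theorem eLpNorm_convolution_le {g k : G → ℂ} (hg : AEStronglyMeasurable g μ)
    (hk : AEStronglyMeasurable k μ) {p : ℝ≥0∞} (hp : 1 ≤ p) :
    eLpNorm (g ⋆[ContinuousLinearMap.mul ℂ ℂ, μ] k) p μ ≤ eLpNorm g p μ * eLpNorm k 1 μ := by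
  have hbound : ∀ x, ‖(g ⋆[ContinuousLinearMap.mul ℂ ℂ, μ] k) x‖ₑ ≤
      ∫⁻ t, ‖g t‖ₑ * ‖k (x - t)‖ₑ ∂μ := fun x => by
    refine (enorm_integral_le_lintegral_enorm _).trans (le_of_eq ?_)
    simp
  have hkx : ∀ x, AEMeasurable (fun t => ‖k (x - t)‖ₑ) μ := fun x =>
    (hk.comp_quasiMeasurePreserving (quasiMeasurePreserving_sub_left μ x)).enorm
  have hkint : ∀ x, ∫⁻ t, ‖k (x - t)‖ₑ ∂μ = eLpNorm k 1 μ := fun x => by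
    rw [eLpNorm_one_eq_lintegral_enorm, lintegral_sub_left_eq_self (fun t => ‖k t‖ₑ) x]
  have hp0 : p ≠ 0 := (zero_lt_one.trans_le hp).ne'
  by_cases hptop : p = ⊤
  · subst hptop
    rw [eLpNorm_exponent_top, eLpNorm_exponent_top]
    refine eLpNormEssSup_le_of_ae_enorm_bound (Filter.Eventually.of_forall fun x => ?_)
    calc ‖(g ⋆[ContinuousLinearMap.mul ℂ ℂ, μ] k) x‖ₑ
        ≤ ∫⁻ t, ‖g t‖ₑ * ‖k (x - t)‖ₑ ∂μ := hbound x
      _ ≤ ∫⁻ t, eLpNormEssSup g μ * ‖k (x - t)‖ₑ ∂μ := by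
          refine lintegral_mono_ae ?_
          filter_upwards [enorm_ae_le_eLpNormEssSup g μ] with t ht
          gcongr
      _ = eLpNormEssSup g μ * eLpNorm k 1 μ := by
          rw [lintegral_const_mul'' _ (hkx x), hkint]
  · have hr : 1 ≤ p.toReal := by
      rw [← ENNReal.toReal_one]
      exact ENNReal.toReal_mono hptop hp
    have hr0 : 0 < p.toReal := by linarith
    rw [eLpNorm_eq_lintegral_rpow_enorm_toReal hp0 hptop,
      eLpNorm_eq_lintegral_rpow_enorm_toReal (f := g) hp0 hptop]
    set r := p.toReal
    set K := eLpNorm k 1 μ with hK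
    have hjoint : AEMeasurable (Function.uncurry fun x t => ‖g t‖ₑ ^ r * ‖k (x - t)‖ₑ)
        (μ.prod μ) := by
      have h1 : AEMeasurable (fun z : G × G => ‖g z.2‖ₑ ^ r) (μ.prod μ) :=
        hg.comp_snd.enorm.pow_const r
      have h2 : AEMeasurable (fun z : G × G => ‖k (z.1 - z.2)‖ₑ) (μ.prod μ) :=
        (hk.comp_quasiMeasurePreserving (quasiMeasurePreserving_sub μ μ)).enorm
      exact h1.mul h2
    have hint : ∫⁻ x, ‖(g ⋆[ContinuousLinearMap.mul ℂ ℂ, μ] k) x‖ₑ ^ r ∂μ ≤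
        (∫⁻ t, ‖g t‖ₑ ^ r ∂μ) * K ^ r := by
      calc ∫⁻ x, ‖(g ⋆[ContinuousLinearMap.mul ℂ ℂ, μ] k) x‖ₑ ^ r ∂μ
          ≤ ∫⁻ x, (∫⁻ t, ‖g t‖ₑ ^ r * ‖k (x - t)‖ₑ ∂μ) * K ^ (r - 1) ∂μ := by
            refine lintegral_mono fun x => ?_
            refine (ENNReal.rpow_le_rpow (hbound x) hr0.le).trans ?_
            refine (lintegral_mul_rpow_le hg.enorm (hkx x) hr).trans (le_of_eq ?_)
            rw [hkint]
        _ = (∫⁻ x, ∫⁻ t, ‖g t‖ₑ ^ r * ‖k (x - t)‖ₑ ∂μ ∂μ) * K ^ (r - 1) :=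
            lintegral_mul_const'' _ hjoint.lintegral_prod_right'
        _ = (∫⁻ t, ∫⁻ x, ‖g t‖ₑ ^ r * ‖k (x - t)‖ₑ ∂μ ∂μ) * K ^ (r - 1) := by
            rw [lintegral_lintegral_swap hjoint]
        _ = (∫⁻ t, ‖g t‖ₑ ^ r * K ∂μ) * K ^ (r - 1) := by
            congr 2
            ext t
            have hkt : AEMeasurable (fun x => ‖k (x - t)‖ₑ) μ :=
              (hk.comp_quasiMeasurePreserving
                (measurePreserving_sub_right μ t).quasiMeasurePreserving).enorm
            rw [lintegral_const_mul'' _ hkt, hK, eLpNorm_one_eq_lintegral_enorm,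
              lintegral_sub_right_eq_self (fun x => ‖k x‖ₑ) t]
        _ = (∫⁻ t, ‖g t‖ₑ ^ r ∂μ) * K ^ r := by
            rw [lintegral_mul_const'' _ (hg.enorm.pow_const r), mul_assoc]
            congr 1
            nth_rewrite 1 [← ENNReal.rpow_one K]
            rw [← ENNReal.rpow_add_of_nonneg _ _ zero_le_one (by linarith)]
            congr 1
            ring
    refine (ENNReal.rpow_le_rpow hint (by positivity)).trans (le_of_eq ?_)
    rw [ENNReal.mul_rpow_of_nonneg _ _ (by positivity), ← ENNReal.rpow_mul,
      mul_one_div_cancel hr0.ne', ENNReal.rpow_one]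

end Young

/-! ### Reproducing formulas for convolutions. -/

section Reproducing

open scoped Convolution

variable {d : ℕ}

theorem bddAbove_range_norm (ψ : 𝓢(Space d, ℂ)) : BddAbove (Set.range fun x => ‖ψ x‖) :=
  ⟨SchwartzMap.seminorm ℝ 0 0 ψ, by rintro _ ⟨x, rfl⟩; exact ψ.norm_le_seminorm ℝ x⟩

theorem conv_eq_convolution {g : Space d → ℂ} {u : 𝓢'(Space d, ℂ)} (h : Represents g u)
    (ψ : 𝓢(Space d, ℂ)) : conv u ψ = g ⋆[ContinuousLinearMap.mul ℂ ℂ] ψ := by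
  ext x
  rw [conv, (h _).2]
  rfl

theorem convolutionExistsAt_of_bddAbove {g k : Space d → ℂ} (hg : Integrable g)
    (hk : Continuous k) (hb : BddAbove (Set.range fun x => ‖k x‖)) (x : Space d) :
    ConvolutionExistsAt g k x (ContinuousLinearMap.mul ℂ ℂ) := by
  obtain ⟨C, hC⟩ := hb
  exact hg.mul_bdd (c := C) (by fun_prop) (Filter.Eventually.of_forall fun t => hC ⟨_, rfl⟩)

theorem convolution_schwartz_assoc {g : Space d → ℂ} (hg : Integrable g) (ψ φ : 𝓢(Space d, ℂ)) :
    (g ⋆[ContinuousLinearMap.mul ℂ ℂ] ψ) ⋆[ContinuousLinearMap.mul ℂ ℂ] φ =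
      g ⋆[ContinuousLinearMap.mul ℂ ℂ]
        (SchwartzMap.convolution (ContinuousLinearMap.mul ℂ ℂ) ψ φ) := by
  ext x
  have e : ⇑(SchwartzMap.convolution (ContinuousLinearMap.mul ℂ ℂ) ψ φ) =
      ψ ⋆[ContinuousLinearMap.mul ℂ ℂ] φ := by
    ext y
    exact SchwartzMap.convolution_apply _ _ _ _
  rw [e]
  obtain ⟨C, hC⟩ := bddAbove_range_norm φ
  have hφ : ∀ y, ‖φ y‖ ≤ C := fun y => hC ⟨y, rfl⟩
  have hnorm : BddAbove (Set.range fun y => ‖‖φ y‖‖) := by simpa using bddAbove_range_norm φ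
  refine convolution_assoc _ _ _ _ (fun a b c => by simp [mul_assoc]) hg.aestronglyMeasurable
    ψ.continuous.aestronglyMeasurable φ.continuous.aestronglyMeasurable
    (Filter.Eventually.of_forall fun y =>
      convolutionExistsAt_of_bddAbove hg ψ.continuous (bddAbove_range_norm ψ) y)
    (Filter.Eventually.of_forall fun y => ?_) ?_
  · exact (ψ.integrable (μ := volume)).norm.mul_bdd (c := C) (by fun_prop)
      (Filter.Eventually.of_forall fun t => by simpa using hφ _)
  · have hcont := hnorm.continuous_convolution_right_of_integrable (ContinuousLinearMap.mul ℝ ℝ)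
      (ψ.integrable (μ := volume)).norm φ.continuous.norm
    refine hg.norm.mul_bdd (c := (∫ t, ‖ψ t‖) * C) (by fun_prop)
      (Filter.Eventually.of_forall fun t => ?_)
    refine (norm_integral_le_integral_norm _).trans ?_
    rw [← integral_mul_const]
    refine integral_mono_of_nonneg (Filter.Eventually.of_forall fun s => norm_nonneg _)
      ((ψ.integrable (μ := volume)).norm.mul_const C) (Filter.Eventually.of_forall fun s => ?_)
    simpa using mul_le_mul_of_nonneg_left (hφ (x - t - s)) (norm_nonneg (ψ s))

/-- Both sides have the same Fourier transform, as convolution becomes a product, and Fourier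
inversion concludes. -/
theorem eq_sum_convolution {φ : 𝓢(Space d, ℂ)} {ψ : ℕ → 𝓢(Space d, ℂ)} {s : Finset ℕ}
    (h : ∀ ξ, (∑ j ∈ s, 𝓕 (ψ j) ξ) * 𝓕 φ ξ = 𝓕 φ ξ) :
    φ = ∑ j ∈ s, SchwartzMap.convolution (ContinuousLinearMap.mul ℂ ℂ) (ψ j) φ := by
  have h1 : 𝓕 φ = 𝓕 (∑ j ∈ s, SchwartzMap.convolution (ContinuousLinearMap.mul ℂ ℂ) (ψ j) φ) := by
    ext ξ
    have h2 : 𝓕 (∑ j ∈ s, SchwartzMap.convolution (ContinuousLinearMap.mul ℂ ℂ) (ψ j) φ) =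
        ∑ j ∈ s, 𝓕 (SchwartzMap.convolution (ContinuousLinearMap.mul ℂ ℂ) (ψ j) φ) :=
      map_sum (FourierTransform.fourierCLM ℂ 𝓢(Space d, ℂ)) _ _
    rw [h2, ← h ξ, Finset.sum_mul, _root_.sum_apply]
    refine Finset.sum_congr rfl fun j _ => ?_
    rw [SchwartzMap.fourier_convolution, SchwartzMap.pairing_apply_apply]
    rfl
  have h3 := congrArg (fun θ : 𝓢(Space d, ℂ) => 𝓕⁻ θ) h1
  simpa using h3

/-- A reproducing formula on the Fourier side bounds a convolution by the blocks that occur in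
it. -/
theorem eLpNorm_convolution_le_sum {g : Space d → ℂ} (hg : Integrable g) {φ : 𝓢(Space d, ℂ)}
    {ψ : ℕ → 𝓢(Space d, ℂ)} {s : Finset ℕ} (h : ∀ ξ, (∑ j ∈ s, 𝓕 (ψ j) ξ) * 𝓕 φ ξ = 𝓕 φ ξ)
    {p : ℝ≥0∞} (hp : 1 ≤ p) :
    eLpNorm (g ⋆[ContinuousLinearMap.mul ℂ ℂ] φ) p ≤
      ∑ j ∈ s, eLpNorm (g ⋆[ContinuousLinearMap.mul ℂ ℂ] (ψ j)) p * eLpNorm φ 1 := by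
  have hcont : ∀ θ : 𝓢(Space d, ℂ), Continuous (g ⋆[ContinuousLinearMap.mul ℂ ℂ] θ) := fun θ =>
    (bddAbove_range_norm θ).continuous_convolution_right_of_integrable _ hg θ.continuous
  have e : (g ⋆[ContinuousLinearMap.mul ℂ ℂ] φ) =
      ∑ j ∈ s, (g ⋆[ContinuousLinearMap.mul ℂ ℂ]
        (SchwartzMap.convolution (ContinuousLinearMap.mul ℂ ℂ) (ψ j) φ)) := by
    ext x
    rw [Finset.sum_apply]
    conv_lhs => rw [eq_sum_convolution h]
    simp only [convolution_def]
    rw [← integral_finsetSum]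
    · simp
    · intro j _
      exact convolutionExistsAt_of_bddAbove hg (SchwartzMap.continuous _)
        (bddAbove_range_norm _) x
  rw [e]
  refine (eLpNorm_sum_le (fun j _ => (hcont _).aestronglyMeasurable) hp).trans
    (Finset.sum_le_sum fun j _ => ?_)
  rw [← convolution_schwartz_assoc hg]
  exact eLpNorm_convolution_le (hcont _).aestronglyMeasurable
    φ.continuous.aestronglyMeasurable hp

end Reproducing

/-! ### Linear changes of variables under the Fourier transform. -/

section Dilates

variable {d : ℕ}

theorem det_toEuclideanLin (A : Matrix (Fin d) (Fin d) ℝ) :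
    LinearMap.det (Matrix.toEuclideanLin A) = A.det :=
  LinearMap.det_toLpLin 2 A

theorem inner_toEuclideanLin_transpose (A : Matrix (Fin d) (Fin d) ℝ) (x y : Space d) :
    inner ℝ x (Matrix.toEuclideanLin Aᵀ y) = inner ℝ (Matrix.toEuclideanLin A x) y := by
  rw [← Matrix.conjTranspose_eq_transpose_of_trivial,
    Matrix.toEuclideanLin_conjTranspose_eq_adjoint, LinearMap.adjoint_inner_right]

theorem isClosedEmbedding_toEuclideanLin {A : Matrix (Fin d) (Fin d) ℝ} (hA : A.det ≠ 0) :
    Topology.IsClosedEmbedding (Matrix.toEuclideanLin A) := by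
  refine LinearMap.isClosedEmbedding_of_injective ?_
  by_contra h
  exact hA (by rw [← det_toEuclideanLin]; exact LinearMap.det_eq_zero_iff_ker_ne_bot.2 h)

theorem map_toEuclideanLin_volume {A : Matrix (Fin d) (Fin d) ℝ} (hA : A.det ≠ 0) :
    Measure.map (Matrix.toEuclideanLin A) (volume : Measure (Space d)) =
      ENNReal.ofReal |A.det⁻¹| • volume := by
  rw [Measure.map_linearMap_addHaar_eq_smul_addHaar volume (by rwa [det_toEuclideanLin]),
    det_toEuclideanLin]

theorem integral_comp_toEuclideanLin {F : Type*} [NormedAddCommGroup F] [NormedSpace ℝ F]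
    {A : Matrix (Fin d) (Fin d) ℝ} (hA : A.det ≠ 0) (f : Space d → F) :
    ∫ x, f (Matrix.toEuclideanLin A x) = |A.det⁻¹| • ∫ x, f x := by
  rw [← (isClosedEmbedding_toEuclideanLin hA).measurableEmbedding.integral_map,
    map_toEuclideanLin_volume hA, integral_smul_measure, ENNReal.toReal_ofReal (abs_nonneg _)]

theorem lintegral_comp_toEuclideanLin {A : Matrix (Fin d) (Fin d) ℝ} (hA : A.det ≠ 0)
    (f : Space d → ℝ≥0∞) :
    ∫⁻ x, f (Matrix.toEuclideanLin A x) = ENNReal.ofReal |A.det⁻¹| * ∫⁻ x, f x := by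
  rw [← (isClosedEmbedding_toEuclideanLin hA).measurableEmbedding.lintegral_map,
    map_toEuclideanLin_volume hA, lintegral_smul_measure, smul_eq_mul]

/-- A linear change of variables on the Fourier side preserves the `L¹` norm. -/
theorem eLpNorm_one_eq_of_fourier_eq {A B : Matrix (Fin d) (Fin d) ℝ} (hAB : Aᵀ * B = 1)
    {ψ φ : 𝓢(Space d, ℂ)} (h : ∀ ξ, 𝓕 φ ξ = 𝓕 ψ (Matrix.toEuclideanLin B ξ)) :
    eLpNorm φ 1 = eLpNorm ψ 1 := by
  have hdet : A.det * B.det = 1 := by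
    rw [← Matrix.det_transpose A, ← Matrix.det_mul, hAB, Matrix.det_one]
  have hA : A.det ≠ 0 := left_ne_zero_of_mul_eq_one hdet
  have hB : B.det ≠ 0 := right_ne_zero_of_mul_eq_one hdet
  -- Change of variables in the inversion integral; the hypothesis `Aᵀ B = 1` turns the phase at `x`
  -- into the phase at `A x`.
  have key : ∀ x, φ x = |B.det⁻¹| • ψ (Matrix.toEuclideanLin A x) := fun x => by
    have h1 : φ x = 𝓕⁻ (𝓕 φ) x := by simp
    have h2 : ψ (Matrix.toEuclideanLin A x) = 𝓕⁻ (𝓕 ψ) (Matrix.toEuclideanLin A x) := by simp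
    rw [h1, h2, SchwartzMap.fourierInv_coe, SchwartzMap.fourierInv_coe, Real.fourierInv_eq,
      Real.fourierInv_eq, ← integral_comp_toEuclideanLin hB]
    refine integral_congr_ae (Filter.Eventually.of_forall fun ξ => ?_)
    have h3 : inner ℝ (Matrix.toEuclideanLin B ξ) (Matrix.toEuclideanLin A x) = inner ℝ ξ x := by
      rw [real_inner_comm, ← inner_toEuclideanLin_transpose, ← toEuclideanLin_mul, hAB,
        toEuclideanLin_one, real_inner_comm]
    simp only [h3, h ξ]
  rw [eLpNorm_one_eq_lintegral_enorm, eLpNorm_one_eq_lintegral_enorm]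
  simp only [key, enorm_smul]
  rw [lintegral_const_mul' _ _ (by simp), lintegral_comp_toEuclideanLin hA (fun x => ‖ψ x‖ₑ),
    ← mul_assoc, Real.enorm_eq_ofReal (abs_nonneg _), ← ENNReal.ofReal_mul (abs_nonneg _),
    ← abs_mul, ← mul_inv, mul_comm B.det, hdet]
  simp

end Dilates

/-! ### Spectral supports and `L¹` norms of the blocks. -/

section LittlewoodPaley

variable {d : ℕ} {E : Matrix (Fin d) (Fin d) ℝ} {ρ : Space d → ℝ} {ψ : ℕ → 𝓢(Space d, ℂ)}

theorem scale_two_neg_natCast (M : Matrix (Fin d) (Fin d) ℝ) (j : ℕ) (ξ : Space d) :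
    scale 2 (-(j : ℝ) • M) ξ = scale ((2 : ℝ) ^ j)⁻¹ M ξ := by
  rw [← scale_rpow two_pos, Real.rpow_neg two_pos.le, Real.rpow_natCast]

theorem IsLittlewoodPaley.fourier_succ (hψ : IsLittlewoodPaley E ρ ψ) (j : ℕ) (ξ : Space d) :
    𝓕 (ψ (j + 1)) ξ = 𝓕 (ψ 0) (scale ((2 : ℝ) ^ (j + 1))⁻¹ Eᵀ ξ) -
      𝓕 (ψ 0) (scale ((2 : ℝ) ^ j)⁻¹ Eᵀ ξ) := by
  rw [hψ.succ, ← scale_two_neg_natCast, ← scale_two_neg_natCast, Nat.cast_add_one]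

/-- The differences telescope. -/
theorem IsLittlewoodPaley.sum_fourier (hψ : IsLittlewoodPaley E ρ ψ) (J : ℕ) (ξ : Space d) :
    ∑ j ∈ Finset.range (J + 1), 𝓕 (ψ j) ξ = 𝓕 (ψ 0) (scale ((2 : ℝ) ^ J)⁻¹ Eᵀ ξ) := by
  induction J with
  | zero => simp [scale_one]
  | succ J ih => rw [Finset.sum_range_succ, ih, hψ.fourier_succ]; ring

theorem IsPseudoNorm.scale_two_pow_inv (hρ : IsPseudoNorm Eᵀ ρ) (j : ℕ) (ξ : Space d) :
    ρ (scale ((2 : ℝ) ^ j)⁻¹ Eᵀ ξ) = ρ ξ / 2 ^ j := by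
  rw [hρ.homogeneous _ (by positivity), div_eq_inv_mul]

theorem IsLittlewoodPaley.le_of_fourier_ne_zero (hρ : IsPseudoNorm Eᵀ ρ)
    (hψ : IsLittlewoodPaley E ρ ψ) {j : ℕ} {ξ : Space d} (h : 𝓕 (ψ j) ξ ≠ 0) :
    ρ ξ ≤ 2 ^ (j + 1) := by
  by_contra! hlt
  refine h ?_
  cases j with
  | zero => exact hψ.eq_zero ξ (by simpa using hlt.le)
  | succ j =>
    have hpos : (0 : ℝ) < 2 ^ j := by positivity
    have e : (2 : ℝ) ^ (j + 1 + 1) = 2 * 2 * 2 ^ j := by ring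
    rw [e] at hlt
    rw [hψ.fourier_succ, hψ.eq_zero, hψ.eq_zero, sub_zero]
    · rw [hρ.scale_two_pow_inv, le_div_iff₀ hpos]
      linarith
    · rw [hρ.scale_two_pow_inv, le_div_iff₀ (by positivity), pow_succ]
      linarith

/-- Below the shell both terms of the difference equal `1`. Block `0` has no such lower bound,
whence the shifted index. -/
theorem IsLittlewoodPaley.two_pow_le_of_fourier_ne_zero (hρ : IsPseudoNorm Eᵀ ρ)
    (hψ : IsLittlewoodPaley E ρ ψ) {j : ℕ} {ξ : Space d} (h : 𝓕 (ψ (j + 1)) ξ ≠ 0) :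
    2 ^ j ≤ ρ ξ := by
  by_contra! hlt
  refine h ?_
  have hpos : (0 : ℝ) < 2 ^ j := by positivity
  rw [hψ.fourier_succ, hψ.eq_one, hψ.eq_one, sub_self]
  · rw [hρ.scale_two_pow_inv, div_le_one hpos]
    exact hlt.le
  · rw [hρ.scale_two_pow_inv, div_le_one (by positivity), pow_succ]
    linarith

/-- Block `j + 1` is block `1` with frequencies dilated by `2^{-jEᵀ}`. This makes the constant in
Young's inequality uniform in `j`. -/
theorem IsLittlewoodPaley.eLpNorm_one_succ (hψ : IsLittlewoodPaley E ρ ψ) (j : ℕ) :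
    eLpNorm (ψ (j + 1)) 1 = eLpNorm (ψ 1) 1 := by
  have hj : (0 : ℝ) < 2 ^ j := by positivity
  refine eLpNorm_one_eq_of_fourier_eq (A := matPow (2 ^ j) E) (B := matPow ((2 : ℝ) ^ j)⁻¹ Eᵀ)
    ?_ fun ξ => ?_
  · rw [← matPow_transpose, matPow_mul_matPow hj (inv_pos.2 hj), mul_inv_cancel₀ hj.ne',
      matPow_one]
  · have h := hψ.fourier_succ 0 (scale ((2 : ℝ) ^ j)⁻¹ Eᵀ ξ)
    rw [scale_scale (by positivity) (inv_pos.2 hj), scale_scale (by positivity) (inv_pos.2 hj)] at h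
    rw [hψ.fourier_succ]
    refine Eq.trans ?_ h.symm
    congr 3 <;> simp [pow_succ]

theorem IsLittlewoodPaley.eLpNorm_one_le (hψ : IsLittlewoodPaley E ρ ψ) (j : ℕ) :
    eLpNorm (ψ j) 1 ≤ eLpNorm (ψ 0) 1 + eLpNorm (ψ 1) 1 := by
  cases j with
  | zero => exact le_self_add
  | succ j => rw [hψ.eLpNorm_one_succ]; exact le_add_self

theorem eLpNorm_schwartz_one_ne_top (φ : 𝓢(Space d, ℂ)) : eLpNorm φ 1 ≠ ⊤ :=
  (memLp_one_iff_integrable.2 (φ.integrable (μ := volume))).eLpNorm_ne_top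

end LittlewoodPaley

/-! ### Transfer of Besov regularity between the two anisotropies. -/

section Embedding

open scoped Convolution

variable {d : ℕ} {D E₁ E₂ : Matrix (Fin d) (Fin d) ℝ} {ρ₁ ρ₂ : Space d → ℝ}
  {ψ₁ ψ₂ : ℕ → 𝓢(Space d, ℂ)}

theorem ofReal_two_rpow_natCast_mul (k : ℕ) (a : ℝ) :
    ENNReal.ofReal ((2 : ℝ) ^ ((k : ℝ) * a)) = ENNReal.ofReal ((2 : ℝ) ^ a) ^ k := by
  rw [mul_comm, Real.rpow_mul two_pos.le, Real.rpow_natCast, ENNReal.ofReal_pow (by positivity)]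

theorem ofReal_two_rpow_add (a b : ℝ) : ENNReal.ofReal ((2 : ℝ) ^ (a + b)) =
    ENNReal.ofReal ((2 : ℝ) ^ a) * ENNReal.ofReal ((2 : ℝ) ^ b) := by
  rw [Real.rpow_add two_pos, ENNReal.ofReal_mul (by positivity)]

theorem tsum_geometric_ne_top {r : ℝ≥0∞} (hr : r < 1) : ∑' j : ℕ, r ^ j ≠ ⊤ := by
  rw [ENNReal.tsum_geometric]
  exact ENNReal.inv_ne_top.2 (tsub_pos_of_lt hr).ne'

theorem ofReal_two_rpow_neg_lt_one {a : ℝ} (ha : a < 0) : ENNReal.ofReal ((2 : ℝ) ^ a) < 1 :=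
  ENNReal.ofReal_lt_one.2 (Real.rpow_lt_one_of_one_lt_of_neg one_lt_two ha)

/-- The frequency blocks of two analyses with the same real diagonalizable part can only interact
if their indices are almost comparable. -/
theorem exists_index_le (hE₁ : IsAnisotropy E₁) (hE₂ : IsAnisotropy E₂)
    (hD₁ : IsRealDiagonalizablePart D E₁) (hD₂ : IsRealDiagonalizablePart D E₂)
    (hρ₁ : IsPseudoNorm E₁ᵀ ρ₁) (hρ₂ : IsPseudoNorm E₂ᵀ ρ₂)
    (hψ₁ : IsLittlewoodPaley E₁ ρ₁ ψ₁) (hψ₂ : IsLittlewoodPaley E₂ ρ₂ ψ₂) {δ : ℝ} (hδ : 0 < δ) :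
    ∃ C : ℝ, ∀ (j k : ℕ) (ξ : Space d), 𝓕 (ψ₁ j) ξ ≠ 0 → 𝓕 (ψ₂ k) ξ ≠ 0 →
      (k : ℝ) ≤ (1 + δ) * j + C := by
  obtain ⟨C, hC, h⟩ := exists_le_of_two_pow_le hE₁ hE₂ hD₁ hD₂ hρ₁ hρ₂ hδ
  -- The shifts `j + 1` in the upper and `k + 1` in the lower spectral bound cost `1 + δ` and `1`.
  refine ⟨2 + δ + C, fun j k ξ h₁ h₂ => ?_⟩
  cases k with
  | zero =>
    have : 0 ≤ (1 + δ) * j := by positivity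
    push_cast
    linarith
  | succ k =>
    have := h (j + 1) k ξ (hψ₂.two_pow_le_of_fourier_ne_zero hρ₂ h₂)
      (hψ₁.le_of_fourier_ne_zero hρ₁ h₁)
    push_cast at this ⊢
    linarith

/-- A long enough partial sum of the first analysis equals `1` on the spectrum of block `k`, and the
indices that do not meet that spectrum can be dropped. The comparison is used in the reverse
direction, with `δ = 1`, as only finiteness is needed. -/
theorem exists_sum_fourier_mul_eq (hE₁ : IsAnisotropy E₁) (hE₂ : IsAnisotropy E₂)
    (hD₁ : IsRealDiagonalizablePart D E₁) (hD₂ : IsRealDiagonalizablePart D E₂)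
    (hρ₁ : IsPseudoNorm E₁ᵀ ρ₁) (hρ₂ : IsPseudoNorm E₂ᵀ ρ₂)
    (hψ₁ : IsLittlewoodPaley E₁ ρ₁ ψ₁) (hψ₂ : IsLittlewoodPaley E₂ ρ₂ ψ₂) (k : ℕ) :
    ∃ s : Finset ℕ, (∀ j ∈ s, ∃ ξ, 𝓕 (ψ₁ j) ξ ≠ 0 ∧ 𝓕 (ψ₂ k) ξ ≠ 0) ∧
      ∀ ξ, (∑ j ∈ s, 𝓕 (ψ₁ j) ξ) * 𝓕 (ψ₂ k) ξ = 𝓕 (ψ₂ k) ξ := by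
  classical
  obtain ⟨C, -, h⟩ := exists_le_of_two_pow_le hE₂ hE₁ hD₂ hD₁ hρ₂ hρ₁ one_pos
  obtain ⟨J, hJ⟩ := exists_nat_gt ((1 + 1) * ((k + 1 : ℕ) : ℝ) + C)
  refine ⟨(Finset.range (J + 1)).filter fun j => ∃ ξ, 𝓕 (ψ₁ j) ξ ≠ 0 ∧ 𝓕 (ψ₂ k) ξ ≠ 0,
    fun j hj => (Finset.mem_filter.1 hj).2, fun ξ => ?_⟩
  by_cases hξ : 𝓕 (ψ₂ k) ξ = 0
  · rw [hξ, mul_zero]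
  have hsum : ∑ j ∈ (Finset.range (J + 1)).filter fun j => ∃ ξ, 𝓕 (ψ₁ j) ξ ≠ 0 ∧ 𝓕 (ψ₂ k) ξ ≠ 0,
      𝓕 (ψ₁ j) ξ = ∑ j ∈ Finset.range (J + 1), 𝓕 (ψ₁ j) ξ :=
    Finset.sum_filter_of_ne fun j _ hj => ⟨ξ, hj, hξ⟩
  have hle : ρ₁ ξ ≤ 2 ^ J := by
    by_contra! hlt
    exact absurd (h (k + 1) J ξ hlt.le (hψ₂.le_of_fourier_ne_zero hρ₂ hξ)) (not_le.2 hJ)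
  rw [hsum, hψ₁.sum_fourier, hψ₁.eq_one, one_mul]
  rw [hρ₁.scale_two_pow_inv, div_le_one (by positivity)]
  exact hle

/-- Half of the gap `s - σ` pays for the distortion between `j` and `k`; the other half leaves a
factor geometric in `j`, to be summed over the blocks. -/
theorem le_of_two_rpow_mul_le {X A : ℝ≥0∞} {s σ b : ℝ} {j k : ℕ}
    (h : ENNReal.ofReal ((2 : ℝ) ^ ((j : ℝ) * s)) * X ≤ A)
    (hjk : k * σ ≤ (s + σ) / 2 * j + b) :
    X ≤ A * ENNReal.ofReal ((2 : ℝ) ^ b) * ENNReal.ofReal ((2 : ℝ) ^ ((k : ℝ) * -σ)) *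
      ENNReal.ofReal ((2 : ℝ) ^ (-((s - σ) / 2))) ^ j := by
  have hone : ENNReal.ofReal ((2 : ℝ) ^ ((j : ℝ) * -s)) *
      ENNReal.ofReal ((2 : ℝ) ^ ((j : ℝ) * s)) = 1 := by
    rw [← ofReal_two_rpow_add, mul_neg, neg_add_cancel, Real.rpow_zero, ENNReal.ofReal_one]
  have hexp : (j : ℝ) * -s ≤ b + (k : ℝ) * -σ + (j : ℝ) * -((s - σ) / 2) := by linarith
  calc X = ENNReal.ofReal ((2 : ℝ) ^ ((j : ℝ) * -s)) *
        (ENNReal.ofReal ((2 : ℝ) ^ ((j : ℝ) * s)) * X) := by rw [← mul_assoc, hone, one_mul]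
    _ ≤ ENNReal.ofReal ((2 : ℝ) ^ (b + (k : ℝ) * -σ + (j : ℝ) * -((s - σ) / 2))) * A := by
        gcongr
        exact one_le_two
    _ = _ := by
        rw [ofReal_two_rpow_add, ofReal_two_rpow_add, ofReal_two_rpow_natCast_mul j]
        ring

theorem sum_mul_le_of_le_geometric {t : Finset ℕ} {X : ℕ → ℝ≥0∞} {a b r l L : ℝ≥0∞}
    (hX : ∀ j ∈ t, X j ≤ a * b * r ^ j) (hl : l ≤ L) :
    ∑ j ∈ t, X j * l ≤ a * L * (∑' j : ℕ, r ^ j) * b := by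
  calc ∑ j ∈ t, X j * l ≤ ∑ j ∈ t, (a * b * r ^ j) * L :=
        Finset.sum_le_sum fun j hj => mul_le_mul' (hX j hj) hl
    _ = a * L * (∑ j ∈ t, r ^ j) * b := by
        rw [Finset.mul_sum, Finset.sum_mul]
        exact Finset.sum_congr rfl fun j _ => by ring
    _ ≤ a * L * (∑' j : ℕ, r ^ j) * b := by
        gcongr
        exact ENNReal.sum_le_tsum t

/-- Decay of the blocks of one analysis gives almost the same decay for the other one. -/
theorem exists_eLpNorm_convolution_le (hE₁ : IsAnisotropy E₁) (hE₂ : IsAnisotropy E₂)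
    (hD₁ : IsRealDiagonalizablePart D E₁) (hD₂ : IsRealDiagonalizablePart D E₂)
    (hρ₁ : IsPseudoNorm E₁ᵀ ρ₁) (hρ₂ : IsPseudoNorm E₂ᵀ ρ₂)
    (hψ₁ : IsLittlewoodPaley E₁ ρ₁ ψ₁) (hψ₂ : IsLittlewoodPaley E₂ ρ₂ ψ₂)
    {g : Space d → ℂ} (hg : Integrable g) {p : ℝ≥0∞} (hp : 1 ≤ p) {s σ : ℝ} (hσ : 0 < σ)
    (hσs : σ < s) {A : ℝ≥0∞} (hA : A ≠ ⊤)
    (h : ∀ j : ℕ, ENNReal.ofReal ((2 : ℝ) ^ ((j : ℝ) * s)) *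
      eLpNorm (g ⋆[ContinuousLinearMap.mul ℂ ℂ] (ψ₁ j)) p ≤ A) :
    ∃ C : ℝ≥0∞, C ≠ ⊤ ∧ ∀ k : ℕ,
      eLpNorm (g ⋆[ContinuousLinearMap.mul ℂ ℂ] (ψ₂ k)) p ≤
        C * ENNReal.ofReal ((2 : ℝ) ^ ((k : ℝ) * -σ)) := by
  -- Chosen so that `(1 + δ) σ` is the midpoint of `σ` and `s`.
  set δ : ℝ := (s - σ) / (2 * σ) with hδ
  have hδ0 : 0 < δ := div_pos (by linarith) (by linarith)
  have hτ : (1 + δ) * σ = (s + σ) / 2 := by rw [hδ]; field_simp; ring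
  obtain ⟨c, hc⟩ := exists_index_le hE₁ hE₂ hD₁ hD₂ hρ₁ hρ₂ hψ₁ hψ₂ hδ0
  set r := ENNReal.ofReal ((2 : ℝ) ^ (-((s - σ) / 2))) with hr
  have hr1 : r < 1 := ofReal_two_rpow_neg_lt_one (by linarith)
  set L : ℝ≥0∞ := eLpNorm (ψ₂ 0) 1 + eLpNorm (ψ₂ 1) 1
  refine ⟨A * ENNReal.ofReal ((2 : ℝ) ^ (c * σ)) * L * ∑' j : ℕ, r ^ j, ?_, fun k => ?_⟩
  · refine ENNReal.mul_ne_top (ENNReal.mul_ne_top (ENNReal.mul_ne_top hA ENNReal.ofReal_ne_top) ?_)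
      (tsum_geometric_ne_top hr1)
    exact ENNReal.add_ne_top.2 ⟨eLpNorm_schwartz_one_ne_top _, eLpNorm_schwartz_one_ne_top _⟩
  obtain ⟨t, ht, hsum⟩ := exists_sum_fourier_mul_eq hE₁ hE₂ hD₁ hD₂ hρ₁ hρ₂ hψ₁ hψ₂ k
  have hblock : ∀ j ∈ t, eLpNorm (g ⋆[ContinuousLinearMap.mul ℂ ℂ] (ψ₁ j)) p ≤
      A * ENNReal.ofReal ((2 : ℝ) ^ (c * σ)) * ENNReal.ofReal ((2 : ℝ) ^ ((k : ℝ) * -σ)) *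
        r ^ j := fun j hj => by
    obtain ⟨ξ, hξ₁, hξ₂⟩ := ht j hj
    have hkj := hc j k ξ hξ₁ hξ₂
    have h1 := mul_le_mul_of_nonneg_right (hc j k ξ hξ₁ hξ₂) hσ.le
    have h2 : ((1 + δ) * j + c) * σ = (s + σ) / 2 * j + c * σ := by rw [← hτ]; ring
    rw [h2] at h1
    exact le_of_two_rpow_mul_le (h j) h1
  exact (eLpNorm_convolution_le_sum hg hsum hp).trans
    (sum_mul_le_of_le_geometric hblock (hψ₂.eLpNorm_one_le k))

theorem le_besovNorm (ψ : ℕ → 𝓢(Space d, ℂ)) (s : ℝ) (p : ℝ≥0∞) {q : ℝ≥0∞} (hq : 0 < q)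
    (u : 𝓢'(Space d, ℂ)) (j : ℕ) :
    ENNReal.ofReal ((2 : ℝ) ^ ((j : ℝ) * s)) * eLpNorm (conv u (ψ j)) p volume ≤
      besovNorm ψ s p q u := by
  rw [besovNorm]
  split_ifs with hqt
  · exact le_iSup (fun j : ℕ => ENNReal.ofReal ((2 : ℝ) ^ ((j : ℝ) * s)) *
      eLpNorm (conv u (ψ j)) p volume) j
  · have hq0 : 0 < q.toReal := ENNReal.toReal_pos hq.ne' hqt
    rw [one_div, ENNReal.le_rpow_inv_iff hq0]
    exact ENNReal.le_tsum j

/-- The gap `σ - s` makes the weighted sequence geometric, hence in `ℓ^q` for every `q > 0`. -/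
theorem besovNorm_lt_top {ψ : ℕ → 𝓢(Space d, ℂ)} {s σ : ℝ} (hs : s < σ) {p q : ℝ≥0∞} (hq : 0 < q)
    {u : 𝓢'(Space d, ℂ)} {C : ℝ≥0∞} (hC : C ≠ ⊤)
    (h : ∀ k : ℕ, eLpNorm (conv u (ψ k)) p volume ≤
      C * ENNReal.ofReal ((2 : ℝ) ^ ((k : ℝ) * -σ))) :
    besovNorm ψ s p q u < ⊤ := by
  set r := ENNReal.ofReal ((2 : ℝ) ^ (s - σ)) with hr
  have hr1 : r < 1 := ofReal_two_rpow_neg_lt_one (by linarith)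
  have hle : ∀ k : ℕ, ENNReal.ofReal ((2 : ℝ) ^ ((k : ℝ) * s)) *
      eLpNorm (conv u (ψ k)) p volume ≤ C * r ^ k := fun k => by
    calc ENNReal.ofReal ((2 : ℝ) ^ ((k : ℝ) * s)) * eLpNorm (conv u (ψ k)) p volume
        ≤ ENNReal.ofReal ((2 : ℝ) ^ ((k : ℝ) * s)) *
          (C * ENNReal.ofReal ((2 : ℝ) ^ ((k : ℝ) * -σ))) := by gcongr; exact h k
      _ = C * r ^ k := by
        rw [hr, ← ofReal_two_rpow_natCast_mul, sub_eq_add_neg, mul_add, ofReal_two_rpow_add]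
        ring
  rw [besovNorm]
  split_ifs with hqt
  · refine (iSup_le fun k => (hle k).trans ?_).trans_lt hC.lt_top
    exact mul_le_of_le_one_right' (pow_le_one' hr1.le k)
  · have hq0 : 0 < q.toReal := ENNReal.toReal_pos hq.ne' hqt
    refine ENNReal.rpow_lt_top_of_nonneg (by positivity) (ne_top_of_le_ne_top ?_
      (ENNReal.tsum_le_tsum fun k => ENNReal.rpow_le_rpow (hle k) hq0.le))
    have e : ∀ k : ℕ, (C * r ^ k) ^ q.toReal = C ^ q.toReal * (r ^ q.toReal) ^ k := fun k => by
      rw [ENNReal.mul_rpow_of_nonneg _ _ hq0.le, ← ENNReal.rpow_natCast, ← ENNReal.rpow_natCast,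
        ← ENNReal.rpow_mul, ← ENNReal.rpow_mul, mul_comm (k : ℝ)]
    simp only [e]
    rw [ENNReal.tsum_mul_left]
    exact ENNReal.mul_ne_top (ENNReal.rpow_ne_top_of_nonneg hq0.le hC)
      (tsum_geometric_ne_top (ENNReal.rpow_lt_one hr1 hq0))

theorem LocallyLp.integrable_mul {p : ℝ≥0∞} (hp : 1 ≤ p) {f φ : Space d → ℂ}
    (hf : LocallyLp p f) (hφ : Continuous φ) (hφc : HasCompactSupport φ) :
    Integrable (fun x => φ x * f x) := by
  have hK : IsCompact (tsupport φ) := hφc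
  have : IsFiniteMeasure (volume.restrict (tsupport φ)) :=
    isFiniteMeasure_restrict.2 hK.measure_lt_top.ne
  have hint : Integrable f (volume.restrict (tsupport φ)) := (hf _ hK).integrable hp
  obtain ⟨C, hC⟩ := hφc.exists_bound_of_continuous hφ
  have hsupp : Function.support (fun x => φ x * f x) ⊆ tsupport φ := fun x hx =>
    subset_tsupport φ (left_ne_zero_of_mul hx)
  rw [← integrableOn_iff_integrable_of_support_subset hsupp]
  exact hint.bdd_mul (c := C) hφ.aestronglyMeasurable (Filter.Eventually.of_forall hC)

/-- Local regularity for one anisotropy gives almost the same local regularity for any other one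
with the same real diagonalizable part. -/
theorem besovLoc_subset (hE₁ : IsAnisotropy E₁) (hE₂ : IsAnisotropy E₂)
    (hD₁ : IsRealDiagonalizablePart D E₁) (hD₂ : IsRealDiagonalizablePart D E₂)
    (hρ₁ : IsPseudoNorm E₁ᵀ ρ₁) (hρ₂ : IsPseudoNorm E₂ᵀ ρ₂)
    (hψ₁ : IsLittlewoodPaley E₁ ρ₁ ψ₁) (hψ₂ : IsLittlewoodPaley E₂ ρ₂ ψ₂)
    {p q : ℝ≥0∞} (hp : 1 ≤ p) (hq : 0 < q) {s s' : ℝ} (hs' : 0 < s') (hs : s' < s) :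
    besovLoc ψ₁ s p q ⊆ besovLoc ψ₂ s' p q := by
  rintro f ⟨hf, h⟩
  refine ⟨hf, fun φ hφ hφc => ?_⟩
  obtain ⟨u, hu, hrep⟩ := h φ hφ hφc
  refine ⟨u, ?_, hrep⟩
  have hg := hf.integrable_mul hp hφ.continuous hφc
  -- The midpoint of `s'` and `s` leaves room for two losses: one in changing the analysis, one in
  -- recovering the `ℓ^q` norm from pointwise decay.
  obtain ⟨C, hC, hdecay⟩ := exists_eLpNorm_convolution_le hE₁ hE₂ hD₁ hD₂ hρ₁ hρ₂ hψ₁ hψ₂ hg hp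
    (s := s) (σ := (s + s') / 2) (by linarith) (by linarith) (A := besovNorm ψ₁ s p q u)
    (ne_of_lt hu) (fun j => by
      rw [← conv_eq_convolution hrep]
      exact le_besovNorm ψ₁ s p hq u j)
  refine besovNorm_lt_top (σ := (s + s') / 2) (by linarith) hq hC fun k => ?_
  rw [conv_eq_convolution hrep]
  exact hdecay k

theorem criticalExponent_le (hE₁ : IsAnisotropy E₁) (hE₂ : IsAnisotropy E₂)
    (hD₁ : IsRealDiagonalizablePart D E₁) (hD₂ : IsRealDiagonalizablePart D E₂)
    (hρ₁ : IsPseudoNorm E₁ᵀ ρ₁) (hρ₂ : IsPseudoNorm E₂ᵀ ρ₂)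
    (hψ₁ : IsLittlewoodPaley E₁ ρ₁ ψ₁) (hψ₂ : IsLittlewoodPaley E₂ ρ₂ ψ₂)
    {p q : ℝ≥0∞} (hp : 1 ≤ p) (hq : 0 < q) (f : Space d → ℂ) :
    criticalExponent ψ₁ p q f ≤ criticalExponent ψ₂ p q f := by
  refine sSup_le ?_
  rintro _ ⟨s, ⟨hs, hf⟩, rfl⟩
  refine le_of_forall_lt fun c hc => ?_
  -- Taking `s'` above `max c 0` keeps it positive, as the supremum ranges over positive smoothness
  -- only.
  obtain ⟨s', h₁, h₂⟩ := EReal.lt_iff_exists_real_btwn.1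
    (max_lt hc (EReal.coe_lt_coe_iff.2 hs : ((0 : ℝ) : EReal) < s))
  obtain ⟨hc', h0⟩ := max_lt_iff.1 h₁
  have h0' : 0 < s' := EReal.coe_lt_coe_iff.1 h0
  exact hc'.trans_le (le_sSup ⟨s', ⟨h0', besovLoc_subset hE₁ hE₂ hD₁ hD₂ hρ₁ hρ₂ hψ₁ hψ₂ hp hq h0'
    (EReal.coe_lt_coe_iff.1 h₂) hf⟩, rfl⟩)

end Embedding

end AnisoBesov

end

/-- The anisotropic local critical exponent of the sample paths of a field `X` depends only on the
real diagonalizable part of the anisotropy: neither the rest of the anisotropy, nor the chosen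
pseudo-norm, nor the chosen Littlewood-Paley analysis plays a role. -/
theorem mainTheorem8 {d : ℕ} {Ω : Type*} (X : AnisoBesov.Space d → Ω → ℂ)
    (p q : ℝ≥0∞) (hp : 1 ≤ p) (hq : 0 < q)
    (ω : Ω) (hX : AnisoBesov.LocallyLp p (fun x => X x ω))
    (E₁ E₂ D : Matrix (Fin d) (Fin d) ℝ)
    (hE₁ : AnisoBesov.IsAnisotropy E₁) (hE₂ : AnisoBesov.IsAnisotropy E₂)
    (hD₁ : AnisoBesov.IsRealDiagonalizablePart D E₁)
    (hD₂ : AnisoBesov.IsRealDiagonalizablePart D E₂)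
    (ρ₁ ρ₂ : AnisoBesov.Space d → ℝ)
    (hρ₁ : AnisoBesov.IsPseudoNorm E₁ᵀ ρ₁) (hρ₂ : AnisoBesov.IsPseudoNorm E₂ᵀ ρ₂)
    (ψ₁ ψ₂ : ℕ → 𝓢(AnisoBesov.Space d, ℂ))
    (hψ₁ : AnisoBesov.IsLittlewoodPaley E₁ ρ₁ ψ₁)
    (hψ₂ : AnisoBesov.IsLittlewoodPaley E₂ ρ₂ ψ₂) :
    AnisoBesov.criticalExponent ψ₁ p q (fun x => X x ω) =
      AnisoBesov.criticalExponent ψ₂ p q (fun x => X x ω) := by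
  open AnisoBesov in
  exact le_antisymm
    (criticalExponent_le hE₁ hE₂ hD₁ hD₂ hρ₁ hρ₂ hψ₁ hψ₂ hp hq _)
    (criticalExponent_le hE₂ hE₁ hD₂ hD₁ hρ₂ hρ₁ hψ₂ hψ₁ hp hq _)
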